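/- Let $N\ge 2$ and let $\mathcal D\subset\{0,1,\dots,N-1\}^2$ be a digit set with $1<|\mathcal D|<N^2$. For $i\in\mathcal D$ put $\varphi_i(x)=\frac1N(x+i)$, $x\in\mathbb R^2$, and let $F=F(N,\mathcal D)$ be the generalized Sierpiński carpet, i.e. the unique non-empty compact set with $F=\bigcup_{i\in\mathcal D}\varphi_i(F)$. For $k\ge1$ and a word $\mathbf i=i_1\cdots i_k\in\mathcal D^k$ put $\varphi_{\mathbf i}=\varphi_{i_1}\circ\cdots\circ\varphi_{i_k}$, and let $\Gamma_k$ be the $k$-th Hata graph: its vertex set is $\mathcal D^k$, and distinct $\mathbf i,\mathbf j\in\mathcal D^k$ are joined by an edge if and only if $\varphi_{\mathbf i}(F)\cap\varphi_{\mathbf j}(F)\ne\varnothing$. For a finite connected graph $G$, a cut vertex is a vertex $v$ such that $G-\{v\}$ is disconnected; $\chi(G)$ is the maximum, over all cut vertices $v$ of $G$, of the number of vertices of the second largest connected component of $G-\{v\}$ (the second entry when the sizes of all components are listed in non-increasing order), and $\chi(G)=0$ if $G$ has no cut vertex. Suppose that $F$ is connected and non-fragile, i.e. there is no decomposition $\mathcal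 D=\mathcal D_1\cup\mathcal D_2$ with $\mathcal D_1\cap\mathcal D_2=\varnothing$ for which $\big(\bigcup_{i\in\mathcal D_1}\varphi_i(F)\big)\cap\big(\bigcup_{i\in\mathcal D_2}\varphi_i(F)\big)$ is a singleton. Then $F$ has a cut point (a point $x\in F$ such that $F\setminus\{x\}$ is not connected) if and only if $\chi(\Gamma_k)\ge|\mathcal D|^{k-1}$ for all $k\ge2$. Moreover, if there exists $k_0\ge2$ such that $\chi(\Gamma_k)\ge|\mathcal D|^{k-1}$ for all $k\ge k_0$, then $F$ has a cut point. -/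

import Mathlib

namespace FractalSquare

/-! ### Generalized Sierpinski carpets

The plane is `ℝ × ℝ`; only its topology enters the notions used below.  A digit set is a finite set
`D` of pairs of elements of `Fin N = {0, …, N - 1}`. -/

/-- The similarity `x ↦ (x + i) / N` of the plane, for a digit `i ∈ {0, …, N - 1}²`. -/
noncomputable def digitMap {N : ℕ} (i : Fin N × Fin N) (x : ℝ × ℝ) : ℝ × ℝ :=
  ((x.1 + (i.1 : ℕ)) / N, (x.2 + (i.2 : ℕ)) / N)

/-- The iterates of the initial pattern: `Q₀ = [0,1]²` and `Qₙ₊₁ = ⋃_{i ∈ D} φᵢ(Qₙ)`. -/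
noncomputable def pattern (N : ℕ) (D : Finset (Fin N × Fin N)) : ℕ → Set (ℝ × ℝ)
  | 0 => Set.Icc (0 : ℝ) 1 ×ˢ Set.Icc (0 : ℝ) 1
  | n + 1 => ⋃ i ∈ D, digitMap i '' pattern N D n

/-- The generalized Sierpinski carpet `F(N, D) = ⋂ₙ Qₙ`.  By `isAttractor_gsc` and
`IsAttractor.eq_gsc` below, it is the unique attractor of the iterated function system
`{φᵢ : i ∈ D}`. -/
noncomputable def gsc (N : ℕ) (D : Finset (Fin N × Fin N)) : Set (ℝ × ℝ) :=
  ⋂ n, pattern N D n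

/-- `K` is an attractor of `{φᵢ : i ∈ D}`: a non-empty compact set with `K = ⋃_{i ∈ D} φᵢ(K)`. -/
def IsAttractor (N : ℕ) (D : Finset (Fin N × Fin N)) (K : Set (ℝ × ℝ)) : Prop :=
  K.Nonempty ∧ IsCompact K ∧ K = ⋃ i ∈ D, digitMap i '' K

theorem continuous_digitMap {N : ℕ} (i : Fin N × Fin N) : Continuous (digitMap i) := by
  unfold digitMap
  fun_prop

theorem dist_digitMap {N : ℕ} (i : Fin N × Fin N) (x y : ℝ × ℝ) :
    dist (digitMap i x) (digitMap i y) = dist x y / N := by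
  have h : ∀ a b c : ℝ, |(a + c) / N - (b + c) / N| = |a - b| / N := by
    intro a b c
    rw [← sub_div, abs_div, Nat.abs_cast]
    congr 2
    ring
  simp only [Prod.dist_eq, digitMap, Real.dist_eq, h]
  exact max_div_div_right (Nat.cast_nonneg N) _ _

theorem digitMap_injective {N : ℕ} (hN : 2 ≤ N) (i : Fin N × Fin N) :
    Function.Injective (digitMap i) := by
  intro x y h
  have h0 : dist x y / N = 0 := by rw [← dist_digitMap i, h, dist_self]
  have hN' : (N : ℝ) ≠ 0 := by positivity
  exact dist_eq_zero.mp ((div_eq_zero_iff.mp h0).resolve_right hN')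

theorem isCompact_pattern (N : ℕ) (D : Finset (Fin N × Fin N)) (n : ℕ) :
    IsCompact (pattern N D n) := by
  induction n with
  | zero => exact isCompact_Icc.prod isCompact_Icc
  | succ n ih => exact D.isCompact_biUnion fun i _ => ih.image (continuous_digitMap i)

theorem pattern_nonempty {N : ℕ} {D : Finset (Fin N × Fin N)} (hD : D.Nonempty) (n : ℕ) :
    (pattern N D n).Nonempty := by
  induction n with
  | zero => exact ⟨(0, 0), by simp [pattern]⟩
  | succ n ih =>
    obtain ⟨i, hi⟩ := hD
    obtain ⟨x, hx⟩ := ih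
    exact ⟨digitMap i x, Set.mem_biUnion (Finset.mem_coe.mpr hi) ⟨x, hx, rfl⟩⟩

theorem pattern_succ_subset {N : ℕ} (hN : 2 ≤ N) (D : Finset (Fin N × Fin N)) (n : ℕ) :
    pattern N D (n + 1) ⊆ pattern N D n := by
  induction n with
  | zero =>
    have key : ∀ (a : ℝ) (c : Fin N), 0 ≤ a → a ≤ 1 →
        0 ≤ (a + (c : ℕ)) / N ∧ (a + (c : ℕ)) / N ≤ 1 := by
      intro a c h0 h1
      have hN' : (0 : ℝ) < N := by positivity
      have hc : ((c : ℕ) : ℝ) + 1 ≤ N := by exact_mod_cast c.2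
      refine ⟨by positivity, ?_⟩
      rw [div_le_one hN']
      linarith
    intro x hx
    simp only [pattern, Set.mem_iUnion, Set.mem_image] at hx
    obtain ⟨i, _, y, ⟨⟨hy1, hy2⟩, hy3, hy4⟩, rfl⟩ := hx
    exact ⟨key _ _ hy1 hy2, key _ _ hy3 hy4⟩
  | succ n ih =>
    exact Set.iUnion₂_mono fun i _ => Set.image_mono ih

/-- The carpet is an attractor of its iterated function system. -/
theorem isAttractor_gsc {N : ℕ} (hN : 2 ≤ N) {D : Finset (Fin N × Fin N)} (hD : D.Nonempty) :
    IsAttractor N D (gsc N D) := by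
  have hanti : Antitone (pattern N D) := antitone_nat_of_succ_le (pattern_succ_subset hN D)
  refine ⟨?_, ?_, ?_⟩
  · exact IsCompact.nonempty_iInter_of_sequence_nonempty_isCompact_isClosed (pattern N D)
      (pattern_succ_subset hN D) (pattern_nonempty hD) (isCompact_pattern N D 0)
      fun n => (isCompact_pattern N D n).isClosed
  · exact (isCompact_pattern N D 0).of_isClosed_subset
      (isClosed_iInter fun n => (isCompact_pattern N D n).isClosed) (Set.iInter_subset _ 0)
  · apply Set.Subset.antisymm
    · intro x hx
      have hx' : ∀ n, ∃ i ∈ D, x ∈ digitMap i '' pattern N D n := by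
        intro n
        have := Set.mem_iInter.mp hx (n + 1)
        simpa only [pattern, Set.mem_iUnion, exists_prop] using this
      have hex : ∃ i ∈ D, ∀ n, x ∈ digitMap i '' pattern N D n := by
        by_contra hcon
        push Not at hcon
        choose! f hf using hcon
        obtain ⟨i, hi, hxi⟩ := hx' (D.sup f)
        exact hf i hi (Set.image_mono (hanti (Finset.le_sup hi)) hxi)
      obtain ⟨i, hi, h⟩ := hex
      refine Set.mem_biUnion (Finset.mem_coe.mpr hi) ?_
      obtain ⟨y, _, rfl⟩ := h 0
      refine ⟨y, Set.mem_iInter.mpr fun n => ?_, rfl⟩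
      obtain ⟨z, hz, hzy⟩ := h n
      rwa [← digitMap_injective hN i hzy]
    · intro x hx
      simp only [Set.mem_iUnion, exists_prop] at hx
      obtain ⟨i, hi, y, hy, rfl⟩ := hx
      refine Set.mem_iInter.mpr fun n => pattern_succ_subset hN D n ?_
      exact Set.mem_biUnion (Finset.mem_coe.mpr hi) ⟨y, Set.mem_iInter.mp hy n, rfl⟩

/-- Uniqueness of the attractor, one inclusion. -/
theorem IsAttractor.subset {N : ℕ} (hN : 2 ≤ N) {D : Finset (Fin N × Fin N)}
    {A B : Set (ℝ × ℝ)} (hA : IsAttractor N D A) (hB : IsAttractor N D B) : A ⊆ B := by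
  obtain ⟨-, hAc, hAe⟩ := hA
  obtain ⟨⟨b, hb⟩, hBc, hBe⟩ := hB
  obtain ⟨C, hC⟩ := hAc.isBounded.subset_closedBall b
  have key : ∀ n : ℕ, ∀ x ∈ A, ∃ y ∈ B, dist x y ≤ C * ((N : ℝ)⁻¹) ^ n := by
    intro n
    induction n with
    | zero =>
      intro x hx
      exact ⟨b, hb, by simpa using hC hx⟩
    | succ n ih =>
      intro x hx
      rw [hAe] at hx
      simp only [Set.mem_iUnion, exists_prop] at hx
      obtain ⟨i, hi, z, hz, rfl⟩ := hx
      obtain ⟨y, hy, hzy⟩ := ih z hz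
      refine ⟨digitMap i y, ?_, ?_⟩
      · rw [hBe]
        exact Set.mem_biUnion (Finset.mem_coe.mpr hi) ⟨y, hy, rfl⟩
      · rw [dist_digitMap, div_eq_mul_inv, pow_succ, ← mul_assoc]
        exact mul_le_mul_of_nonneg_right hzy (by positivity)
  intro x hx
  rw [← hBc.isClosed.closure_eq, Metric.mem_closure_iff]
  intro ε hε
  have hN1 : (N : ℝ)⁻¹ < 1 := inv_lt_one_of_one_lt₀ (by exact_mod_cast hN)
  have hlim : Filter.Tendsto (fun n : ℕ => C * ((N : ℝ)⁻¹) ^ n) Filter.atTop (nhds (C * 0)) :=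
    (tendsto_pow_atTop_nhds_zero_of_lt_one (by positivity) hN1).const_mul C
  rw [mul_zero] at hlim
  obtain ⟨n, hn⟩ := (hlim.eventually (gt_mem_nhds hε)).exists
  obtain ⟨y, hy, hxy⟩ := key n x hx
  exact ⟨y, hy, hxy.trans_lt hn⟩

/-- The carpet is the only attractor of its iterated function system. -/
theorem IsAttractor.eq_gsc {N : ℕ} (hN : 2 ≤ N) {D : Finset (Fin N × Fin N)} (hD : D.Nonempty)
    {K : Set (ℝ × ℝ)} (hK : IsAttractor N D K) : K = gsc N D :=
  (hK.subset hN (isAttractor_gsc hN hD)).antisymm ((isAttractor_gsc hN hD).subset hN hK)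

/-- `x` is a cut point of the (connected) set `X`: `x ∈ X` and `X \ {x}` is disconnected. -/
def IsCutPoint {α : Type*} [TopologicalSpace α] (X : Set α) (x : α) : Prop :=
  x ∈ X ∧ ¬ IsPreconnected (X \ {x})

/-- The (connected) carpet is fragile: `D` is the disjoint union of some `D₁`, `D₂` such that
`(⋃_{i ∈ D₁} φᵢ(F)) ∩ (⋃_{i ∈ D₂} φᵢ(F))` is a singleton. -/
def IsFragile (N : ℕ) (D : Finset (Fin N × Fin N)) : Prop :=
  ∃ D₁ D₂ : Finset (Fin N × Fin N), D₁ ∪ D₂ = D ∧ Disjoint D₁ D₂ ∧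
    ∃ x : ℝ × ℝ,
      (⋃ i ∈ D₁, digitMap i '' gsc N D) ∩ (⋃ i ∈ D₂, digitMap i '' gsc N D) = {x}

/-! ### Hata graphs -/

/-- `φ_w = φ_{w₁} ∘ ⋯ ∘ φ_{w_k}` for a word `w = w₁ ⋯ w_k` of length `k` over `D`. -/
noncomputable def wordMap {N : ℕ} {D : Finset (Fin N × Fin N)} :
    (k : ℕ) → (Fin k → D) → ℝ × ℝ → ℝ × ℝ
  | 0, _ => id
  | k + 1, w => digitMap (w 0 : Fin N × Fin N) ∘ wordMap k (Fin.tail w)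

/-- The `k`-th Hata graph `Γ_k` on the words of length `k` over `D`: distinct words `v`, `w` are
adjacent if and only if `φ_v(F) ∩ φ_w(F) ≠ ∅`. -/
def hataGraph (N : ℕ) (D : Finset (Fin N × Fin N)) (k : ℕ) : SimpleGraph (Fin k → D) where
  Adj v w := v ≠ w ∧ (wordMap k v '' gsc N D ∩ wordMap k w '' gsc N D).Nonempty
  symm := ⟨fun _ _ h => ⟨h.1.symm, by rw [Set.inter_comm]; exact h.2⟩⟩
  loopless := ⟨fun _ h => h.1 rfl⟩

/-! ### The quantity `χ` of a finite graph -/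

/-- The graph `G - {v}`. -/
def deleteVertex {V : Type*} (G : SimpleGraph V) (v : V) : SimpleGraph ({v}ᶜ : Set V) :=
  G.induce {v}ᶜ

/-- `v` is a cut vertex of the (connected) graph `G`: `G - {v}` is disconnected. -/
def IsCutVertex {V : Type*} (G : SimpleGraph V) (v : V) : Prop :=
  ¬ (deleteVertex G v).Preconnected

/-- The list of the numbers of vertices of the connected components of a finite graph, in
non-increasing order (one entry for each component). -/
noncomputable def componentSizes {V : Type*} [Finite V] (G : SimpleGraph V) : List ℕ :=
  letI := Fintype.ofFinite G.ConnectedComponent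
  ((Finset.univ : Finset G.ConnectedComponent).val.map fun C => C.supp.ncard).sort (· ≥ ·)

/-- The number of vertices of a second largest component of `G - {v}` (the entry with index `1`
of the list; it exists whenever `v` is a cut vertex). -/
noncomputable def secondComponentSize {V : Type*} [Finite V] (G : SimpleGraph V) (v : V) : ℕ :=
  (componentSizes (deleteVertex G v)).getD 1 0

open Classical in
/-- `χ(G)`: the largest size of a second largest component of `G - {v}`, over the cut vertices `v`
of the finite (connected) graph `G`; it is `0` if there is no cut vertex. -/
noncomputable def chi {V : Type*} [Fintype V] (G : SimpleGraph V) : ℕ :=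
  (Finset.univ.filter fun v => IsCutVertex G v).sup fun v => secondComponentSize G v

end FractalSquare

namespace FractalSquare

open Filter Topology

section Basic

variable {N : ℕ} {D : Finset (Fin N × Fin N)}

/-! ### Cells -/

/-! Large components give a cut point. If `χ(Γ_k) ≥ |D|^(k-1)`, deleting one cell of level `k`
leaves two disjoint closed unions of cells, each made of at least `|D|^(k-1)` cells
(`exists_separating_cell`). Let `x` be an ultrafilter limit of points of the deleted cells. A
connected closed piece of `F` that misses `x` eventually misses the deleted cell, so the ultrafilter
assigns it to one side. As `F` is locally connected, this splits `F \ {x}` into two relatively open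
sets. Neither is empty: `x` lies in at most four cells of level 4, too few to hold a whole side
(`exists_isCutPoint_of_chi`). Only large `k` matter here.

A cut point gives large components. By non-fragility, a separation of `F \ {x}` restricts to a
separation of some first-level cell containing `x` (`Separation.exists_zoom`), so it can be
magnified forever. Magnifying never lowers the number of coordinates of `x` in `{0, 1}`, and raises
it if `x` lies in two first-level cells. Starting from the maximal number, `x` thus lies in exactly
one cell of each level. If moreover each side contains a whole first-level cell
(`ExtremalSeparation.exists_cells`), these two cells supply `|D|^k` words each, in different
components of `Γ_{k+1}` without the word of the cell at `x` (`le_chi_of_isCutPoint`).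

The hard point is `ExtremalSeparation.exists_cells`. If it fails, then at every stage all siblings
of the cell around `x` lie on one side. If that side never changes, the other side is confined to
cells shrinking to `x` and is empty. If it changes, all contacts of some cell with its siblings pass
through one subcell, and the next level adds a second constraint of this kind.
`ContactSystem.not_nested` rules this out by integer arithmetic on offsets of grid cells: a diagonal
contact is a single point, and non-fragility never allows a cell to have just one contact point. -/

theorem mem_gsc_iff (hN : 2 ≤ N) (hD : D.Nonempty) {x : ℝ × ℝ} :
    x ∈ gsc N D ↔ ∃ i ∈ D, ∃ y ∈ gsc N D, digitMap i y = x := by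
  conv_lhs => rw [(isAttractor_gsc hN hD).2.2]
  simp only [Set.mem_iUnion, Set.mem_image, exists_prop]

theorem digitMap_mem_gsc (hN : 2 ≤ N) {i : Fin N × Fin N} (hi : i ∈ D) {y : ℝ × ℝ}
    (hy : y ∈ gsc N D) : digitMap i y ∈ gsc N D :=
  (mem_gsc_iff hN ⟨i, hi⟩).2 ⟨i, hi, y, hy, rfl⟩

theorem gsc_bounds {x : ℝ × ℝ} (hx : x ∈ gsc N D) :
    0 ≤ x.1 ∧ x.1 ≤ 1 ∧ 0 ≤ x.2 ∧ x.2 ≤ 1 := by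
  have h := Set.mem_iInter.mp hx 0
  simp only [pattern, Set.mem_prod, Set.mem_Icc] at h
  tauto

theorem dist_le_one_of_mem_gsc {x y : ℝ × ℝ} (hx : x ∈ gsc N D) (hy : y ∈ gsc N D) :
    dist x y ≤ 1 := by
  have h1 := gsc_bounds hx
  have h2 := gsc_bounds hy
  rw [Prod.dist_eq, Real.dist_eq, Real.dist_eq]
  refine max_le ?_ ?_ <;> rw [abs_le] <;> constructor <;> linarith

/-- The cell `φ_w(F)` of a word `w` of length `k`. -/
def cell (k : ℕ) (w : Fin k → D) : Set (ℝ × ℝ) := wordMap k w '' gsc N D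

theorem cell_succ (k : ℕ) (w : Fin (k + 1) → D) :
    cell (k + 1) w = digitMap (w 0 : Fin N × Fin N) '' cell k (Fin.tail w) := by
  simp only [cell, wordMap, Set.image_comp]

theorem continuous_wordMap (k : ℕ) (w : Fin k → D) : Continuous (wordMap k w) := by
  induction k with
  | zero => exact continuous_id
  | succ k ih => exact (continuous_digitMap _).comp (ih _)

theorem dist_wordMap (k : ℕ) (w : Fin k → D) (x y : ℝ × ℝ) :
    dist (wordMap k w x) (wordMap k w y) = dist x y / (N : ℝ) ^ k := by
  induction k with
  | zero => simp [wordMap]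
  | succ k ih => simp only [wordMap, Function.comp_apply, dist_digitMap, ih, pow_succ, div_div]

theorem cell_nonempty (h : (gsc N D).Nonempty) (k : ℕ) (w : Fin k → D) : (cell k w).Nonempty :=
  h.image _

theorem isCompact_cell (h : IsCompact (gsc N D)) (k : ℕ) (w : Fin k → D) : IsCompact (cell k w) :=
  h.image (continuous_wordMap k w)

theorem isConnected_cell (h : IsConnected (gsc N D)) (k : ℕ) (w : Fin k → D) :
    IsConnected (cell k w) :=
  h.image _ (continuous_wordMap k w).continuousOn

theorem cell_subset (hN : 2 ≤ N) (k : ℕ) (w : Fin k → D) : cell k w ⊆ gsc N D := by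
  induction k with
  | zero => simp [cell, wordMap]
  | succ k ih =>
    rw [cell_succ]
    rintro _ ⟨y, hy, rfl⟩
    exact digitMap_mem_gsc hN (w 0).2 (ih _ hy)

theorem dist_le_of_mem_cell {k : ℕ} {w : Fin k → D} {x y : ℝ × ℝ} (hx : x ∈ cell k w)
    (hy : y ∈ cell k w) : dist x y ≤ 1 / (N : ℝ) ^ k := by
  obtain ⟨x, hx, rfl⟩ := hx
  obtain ⟨y, hy, rfl⟩ := hy
  rw [dist_wordMap]
  gcongr
  exact dist_le_one_of_mem_gsc hx hy

theorem exists_mem_cell (hN : 2 ≤ N) (hD : D.Nonempty) (k : ℕ) {x : ℝ × ℝ} (hx : x ∈ gsc N D) :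
    ∃ w : Fin k → D, x ∈ cell k w := by
  induction k generalizing x with
  | zero => exact ⟨Fin.elim0, x, hx, rfl⟩
  | succ k ih =>
    obtain ⟨i, hi, y, hy, rfl⟩ := (mem_gsc_iff hN hD).1 hx
    obtain ⟨w, hw⟩ := ih hy
    refine ⟨Fin.cons ⟨i, hi⟩ w, ?_⟩
    rw [cell_succ, Fin.cons_zero, Fin.tail_cons]
    exact ⟨y, hw, rfl⟩

/-- In a finite family of closed sets with connected union, any two members are joined by a
chain of successively intersecting members. -/
theorem reachable_of_isPreconnected_biUnion {V : Type*} [Finite V] {X : Type*}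
    [TopologicalSpace X] (G : SimpleGraph V) (K : V → Set X) (S : Set V)
    (hne : ∀ s ∈ S, (K s).Nonempty) (hcl : ∀ s ∈ S, IsClosed (K s))
    (hconn : IsPreconnected (⋃ s ∈ S, K s))
    (hadj : ∀ s ∈ S, ∀ t ∈ S, s ≠ t → (K s ∩ K t).Nonempty → G.Adj s t)
    {a b : V} (ha : a ∈ S) (hb : b ∈ S) : G.Reachable a b := by
  by_contra hab
  set A : Set V := {s ∈ S | G.Reachable a s}
  set B : Set V := {s ∈ S | ¬ G.Reachable a s}
  have hA : IsClosed (⋃ s ∈ A, K s) := A.toFinite.isClosed_biUnion fun s hs => hcl s hs.1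
  have hB : IsClosed (⋃ s ∈ B, K s) := B.toFinite.isClosed_biUnion fun s hs => hcl s hs.1
  have hcov : (⋃ s ∈ S, K s) ⊆ (⋃ s ∈ A, K s) ∪ (⋃ s ∈ B, K s) := by
    intro x hx
    simp only [Set.mem_iUnion, exists_prop] at hx
    obtain ⟨s, hs, hxs⟩ := hx
    by_cases h : G.Reachable a s
    · exact Or.inl (Set.mem_biUnion (show s ∈ A from ⟨hs, h⟩) hxs)
    · exact Or.inr (Set.mem_biUnion (show s ∈ B from ⟨hs, h⟩) hxs)
  have hAne : ((⋃ s ∈ S, K s) ∩ (⋃ s ∈ A, K s)).Nonempty := by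
    obtain ⟨x, hx⟩ := hne a ha
    exact ⟨x, Set.mem_biUnion ha hx, Set.mem_biUnion (show a ∈ A from ⟨ha, .refl _⟩) hx⟩
  have hBne : ((⋃ s ∈ S, K s) ∩ (⋃ s ∈ B, K s)).Nonempty := by
    obtain ⟨x, hx⟩ := hne b hb
    exact ⟨x, Set.mem_biUnion hb hx, Set.mem_biUnion (show b ∈ B from ⟨hb, hab⟩) hx⟩
  obtain ⟨x, -, hxA, hxB⟩ := isPreconnected_closed_iff.1 hconn _ _ hA hB hcov hAne hBne
  simp only [Set.mem_iUnion, exists_prop] at hxA hxB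
  obtain ⟨s, hs, hxs⟩ := hxA
  obtain ⟨t, ht, hxt⟩ := hxB
  have hst : s ≠ t := by
    rintro rfl
    exact ht.2 hs.2
  exact ht.2 (hs.2.trans (hadj s hs.1 t ht.1 hst ⟨x, hxs, hxt⟩).reachable)

/-! ### Sizes of components -/

/-- Positivity of `n` makes the default value `0` harmless when the list has fewer than two entries.
-/
theorem le_getD_one_iff {l : List ℕ} (hl : l.Pairwise (· ≥ ·)) {n : ℕ} (hn : 0 < n) :
    n ≤ l.getD 1 0 ↔ 2 ≤ l.countP (n ≤ ·) := by
  match l, hl with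
  | [], _ => simp; omega
  | [a], _ =>
    have : List.countP (fun b => decide (n ≤ b)) [a] ≤ 1 := List.countP_le_length
    simp only [List.getD_cons_succ, List.getD_nil]
    omega
  | a :: b :: t, hl =>
    simp only [List.pairwise_cons, List.mem_cons, forall_eq_or_imp] at hl
    simp only [List.getD_cons_succ, List.getD_cons_zero]
    constructor
    · intro h
      rw [List.countP_cons_of_pos (by simpa using h.trans hl.1.1),
        List.countP_cons_of_pos (by simpa using h)]
      omega
    · intro h
      by_contra hlt
      have ht : List.countP (fun b => decide (n ≤ b)) t = 0 := by
        rw [List.countP_eq_zero]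
        intro c hc
        have := hl.2.1 c hc
        simp only [decide_eq_true_eq]
        omega
      rw [List.countP_cons, List.countP_cons, ht] at h
      simp only [decide_eq_true_eq, if_neg hlt] at h
      split_ifs at h <;> omega

theorem le_secondComponentSize_iff {V : Type*} [Finite V] (G : SimpleGraph V) (v : V) {n : ℕ}
    (hn : 0 < n) : n ≤ secondComponentSize G v ↔
      ∃ C C' : (deleteVertex G v).ConnectedComponent, C ≠ C' ∧ n ≤ C.supp.ncard ∧
        n ≤ C'.supp.ncard := by
  classical
  let _ := Fintype.ofFinite (deleteVertex G v).ConnectedComponent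
  rw [secondComponentSize, componentSizes, le_getD_one_iff (Multiset.pairwise_sort _ _) hn,
    ← Multiset.coe_countP, Multiset.sort_eq, Multiset.countP_map, ← Finset.filter_val,
    Finset.card_val]
  change 1 < _ ↔ _
  rw [Finset.one_lt_card]
  simp only [Finset.mem_filter, Finset.mem_univ, true_and]
  constructor
  · rintro ⟨a, ha, b, hb, hab⟩
    exact ⟨a, b, hab, ha, hb⟩
  · rintro ⟨a, b, hab, ha, hb⟩
    exact ⟨a, ha, b, hb, hab⟩

/-- No cut-vertex condition remains on the right: two distinct components already show that `v` is
one. Positivity of `n` excludes the value `0` of an empty supremum. -/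
theorem le_chi_iff {V : Type*} [Fintype V] (G : SimpleGraph V) {n : ℕ} (hn : 0 < n) :
    n ≤ chi G ↔ ∃ v, ∃ C C' : (deleteVertex G v).ConnectedComponent, C ≠ C' ∧
      n ≤ C.supp.ncard ∧ n ≤ C'.supp.ncard := by
  classical
  rw [chi, Finset.le_sup_iff hn]
  simp only [Finset.mem_filter, Finset.mem_univ, true_and]
  constructor
  · rintro ⟨v, -, h⟩
    exact ⟨v, (le_secondComponentSize_iff G v hn).1 h⟩
  · rintro ⟨v, C, C', hne, h⟩
    refine ⟨v, fun hpre => hne ?_, (le_secondComponentSize_iff G v hn).2 ⟨C, C', hne, h⟩⟩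
    exact hpre.subsingleton_connectedComponent.elim C C'

end Basic

/-! ### Contact systems -/

/-- The contact combinatorics of a self-similar subset of the unit square with integer digit set
`D`: `P e` is the set of common points of the set and of its translate by `e`. -/
structure ContactSystem (N : ℤ) (D : ℤ → ℤ → Prop) (P : ℤ → ℤ → Set (ℝ × ℝ))
    (φ : ℤ → ℤ → ℝ × ℝ → ℝ × ℝ) : Prop where
  two_le : 2 ≤ N
  digit : ∀ {a b}, D a b → 0 ≤ a ∧ a ≤ N - 1 ∧ 0 ≤ b ∧ b ≤ N - 1
  range : ∀ {a b}, (P a b).Nonempty → -1 ≤ a ∧ a ≤ 1 ∧ -1 ≤ b ∧ b ≤ 1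
  neg : ∀ {a b}, (P a b).Nonempty → (P (-a) (-b)).Nonempty
  up : ∀ {e₁ e₂ c₁ c₂ d₁ d₂}, D c₁ c₂ → D d₁ d₂ →
    (P (N * e₁ + d₁ - c₁) (N * e₂ + d₂ - c₂)).Nonempty → (P e₁ e₂).Nonempty
  down : ∀ {e₁ e₂ z}, z ∈ P e₁ e₂ → ∃ c₁ c₂ d₁ d₂, D c₁ c₂ ∧ D d₁ d₂ ∧
    ∃ z' ∈ P (N * e₁ + d₁ - c₁) (N * e₂ + d₂ - c₂), z = φ c₁ c₂ z'
  fixed : ∀ {c₁ c₂}, D c₁ c₂ → ∃ κ, ∀ e₁ e₂,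
    (∀ z ∈ P e₁ e₂, ∃ z' ∈ P e₁ e₂, z = φ c₁ c₂ z') → ∀ z ∈ P e₁ e₂, z = κ
  diag : ∀ {e₁ e₂ z z'}, e₁ ≠ 0 → e₂ ≠ 0 → z ∈ P e₁ e₂ → z' ∈ P e₁ e₂ → z = z'
  nonfragile : ∀ {c₁ c₂}, D c₁ c₂ → ∀ p, ∃ e₁ e₂, (e₁ ≠ 0 ∨ e₂ ≠ 0) ∧ D (c₁ + e₁) (c₂ + e₂) ∧
    ∃ z ∈ P e₁ e₂, z ≠ p

/-- All contacts of the set with its translate by `e` take place in the cell with digit `c`. -/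
def OnlyVia (N : ℤ) (D : ℤ → ℤ → Prop) (P : ℤ → ℤ → Set (ℝ × ℝ)) (e₁ e₂ c₁ c₂ : ℤ) : Prop :=
  ∀ a₁ a₂ d₁ d₂, D a₁ a₂ → D d₁ d₂ → (P (N * e₁ + d₁ - a₁) (N * e₂ + d₂ - a₂)).Nonempty →
    a₁ = c₁ ∧ a₂ = c₂

namespace ContactSystem

variable {N : ℤ} {D : ℤ → ℤ → Prop} {P : ℤ → ℤ → Set (ℝ × ℝ)} {φ : ℤ → ℤ → ℝ × ℝ → ℝ × ℝ}

theorem exists_pair (h : ContactSystem N D P φ) {e₁ e₂ c₁ c₂ : ℤ} {z : ℝ × ℝ}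
    (hz : z ∈ P e₁ e₂) (hvia : OnlyVia N D P e₁ e₂ c₁ c₂) :
    ∃ d₁ d₂, D d₁ d₂ ∧ ∃ z' ∈ P (N * e₁ + d₁ - c₁) (N * e₂ + d₂ - c₂), z = φ c₁ c₂ z' := by
  obtain ⟨a₁, a₂, d₁, d₂, ha, hd, z', hz', rfl⟩ := h.down hz
  obtain ⟨rfl, rfl⟩ := hvia a₁ a₂ d₁ d₂ ha hd ⟨z', hz'⟩
  exact ⟨d₁, d₂, hd, z', hz', rfl⟩

/-- The two opposite corner digits that realise a diagonal contact belong to `D`. -/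
theorem corner (h : ContactSystem N D P φ) {e₁ e₂ : ℤ} (h₁ : e₁ = 1 ∨ e₁ = -1)
    (h₂ : e₂ = 1 ∨ e₂ = -1) (hT : (P e₁ e₂).Nonempty) {b₁ b₂ : ℤ}
    (hb₁ : 2 * b₁ = (N - 1) * (1 - e₁)) (hb₂ : 2 * b₂ = (N - 1) * (1 - e₂)) : D b₁ b₂ := by
  obtain ⟨z, hz⟩ := hT
  obtain ⟨a₁, a₂, d₁, d₂, ha, hd, z', hz', -⟩ := h.down hz
  have hr := h.range ⟨z', hz'⟩
  have ha' := h.digit ha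
  have hd' := h.digit hd
  have hN := h.two_le
  obtain ⟨rfl, rfl⟩ : d₁ = b₁ ∧ d₂ = b₂ := by
    rcases h₁ with rfl | rfl <;> rcases h₂ with rfl | rfl <;> omega
  exact hd

/-- If all contacts of the siblings of the first-level cell `c` take place in the cell `c'` of `c`,
then some contact offset `e` of `c` is a coordinate direction, and the cell `c'` is in contact with
at least two cells across `e`. -/
theorem exists_two_pairs (h : ContactSystem N D P φ) {a₁ a₂ c₁ c₂ : ℤ} (ha : D a₁ a₂)
    (hc : D c₁ c₂)
    (hvia : ∀ e₁ e₂, (e₁ ≠ 0 ∨ e₂ ≠ 0) → D (a₁ + e₁) (a₂ + e₂) → OnlyVia N D P e₁ e₂ c₁ c₂) :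
    ∃ e₁ e₂ f₁ f₂ : ℤ, ((e₁ = 0 ∧ (e₂ = 1 ∨ e₂ = -1) ∧ f₂ = 0 ∧ (f₁ = 1 ∨ f₁ = -1)) ∨
        (e₂ = 0 ∧ (e₁ = 1 ∨ e₁ = -1) ∧ f₁ = 0 ∧ (f₂ = 1 ∨ f₂ = -1))) ∧
      D (a₁ + e₁) (a₂ + e₂) ∧ (P e₁ e₂).Nonempty ∧
      (P (e₁ + f₁) (e₂ + f₂)).Nonempty ∧ D (c₁ - (N - 1) * e₁ + f₁) (c₂ - (N - 1) * e₂ + f₂) ∧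
      (D (c₁ - (N - 1) * e₁) (c₂ - (N - 1) * e₂) ∨
        ((P (e₁ - f₁) (e₂ - f₂)).Nonempty ∧
          D (c₁ - (N - 1) * e₁ - f₁) (c₂ - (N - 1) * e₂ - f₂))) := by
  have hN := h.two_le
  have hc' := h.digit hc
  -- Non-fragility is tested at the fixed point `κ` of the map with digit `c'`: if `c'` met its
  -- neighbours across `e` only with offset `e` again, iteration would shrink the contact set to
  -- `κ`.
  obtain ⟨κ, hκ⟩ := h.fixed hc
  obtain ⟨e₁, e₂, he0, hae, z, hz, hzκ⟩ := h.nonfragile ha κ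
  have hev := hvia e₁ e₂ he0 hae
  have her := h.range ⟨z, hz⟩
  -- a contact of `c'` across `e` with an offset different from `e`
  have hne : ∃ d₁ d₂, D d₁ d₂ ∧ (P (N * e₁ + d₁ - c₁) (N * e₂ + d₂ - c₂)).Nonempty ∧
      ¬ (N * e₁ + d₁ - c₁ = e₁ ∧ N * e₂ + d₂ - c₂ = e₂) := by
    by_contra hcon
    push Not at hcon
    refine hzκ (hκ e₁ e₂ (fun y hy => ?_) z hz)
    obtain ⟨d₁, d₂, hd, y', hy', rfl⟩ := h.exists_pair hy hev
    obtain ⟨h1, h2⟩ := hcon d₁ d₂ hd ⟨y', hy'⟩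
    rw [h1, h2] at hy'
    exact ⟨y', hy', rfl⟩
  obtain ⟨d₁, d₂, hd, hT, hd0⟩ := hne
  have hTr := h.range hT
  have hd' := h.digit hd
  obtain ⟨f₁, hf₁⟩ : ∃ f₁, f₁ = N * e₁ + d₁ - c₁ - e₁ := ⟨_, rfl⟩
  obtain ⟨f₂, hf₂⟩ : ∃ f₂, f₂ = N * e₂ + d₂ - c₂ - e₂ := ⟨_, rfl⟩
  -- Where a coordinate of `e` is `1` or `-1`, the digit bounds force the offset of the subcells to
  -- equal it, so `f` vanishes there. As `f ≠ 0`, the direction `e` is axial and `f` is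
  -- perpendicular to it.
  have hcase : (e₁ = 0 ∧ (e₂ = 1 ∨ e₂ = -1) ∧ f₂ = 0 ∧ (f₁ = 1 ∨ f₁ = -1)) ∨
        (e₂ = 0 ∧ (e₁ = 1 ∨ e₁ = -1) ∧ f₁ = 0 ∧ (f₂ = 1 ∨ f₂ = -1)) := by
    have h1 : e₁ = -1 ∨ e₁ = 0 ∨ e₁ = 1 := by omega
    have h2 : e₂ = -1 ∨ e₂ = 0 ∨ e₂ = 1 := by omega
    rcases h1 with rfl | rfl | rfl <;> rcases h2 with rfl | rfl | rfl <;> omega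
  have hdd : D (c₁ - (N - 1) * e₁ + f₁) (c₂ - (N - 1) * e₂ + f₂) := by
    convert hd using 1 <;> [rw [hf₁]; rw [hf₂]] <;> ring
  have hTf : (P (e₁ + f₁) (e₂ + f₂)).Nonempty := by
    convert hT using 2 <;> [rw [hf₁]; rw [hf₂]] <;> ring
  refine ⟨e₁, e₂, f₁, f₂, hcase, hae, ⟨z, hz⟩, hTf, hdd, ?_⟩
  by_contra hcon
  rw [not_or] at hcon
  -- otherwise the contact across `e` is a single point
  have huniq : ∀ d₁' d₂', D d₁' d₂' → (P (N * e₁ + d₁' - c₁) (N * e₂ + d₂' - c₂)).Nonempty →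
      d₁' = d₁ ∧ d₂' = d₂ := by
    intro d₁' d₂' hd₂ hT₂
    have h1 := h.range hT₂
    have h2 := h.digit hd₂
    by_contra hne
    have hoff : (N * e₁ + d₁' - c₁ = e₁ ∧ N * e₂ + d₂' - c₂ = e₂) ∨
        (N * e₁ + d₁' - c₁ = e₁ - f₁ ∧ N * e₂ + d₂' - c₂ = e₂ - f₂) := by
      rcases hcase with ⟨rfl, rfl | rfl, rfl, rfl | rfl⟩ | ⟨rfl, rfl | rfl, rfl, rfl | rfl⟩ <;>
        omega
    rcases hoff with ⟨h3, h4⟩ | ⟨h3, h4⟩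
    · refine hcon.1 ?_
      convert hd₂ using 1 <;> linarith
    · refine hcon.2 ⟨by rwa [h3, h4] at hT₂, ?_⟩
      convert hd₂ using 1 <;> linarith
  have hsub : ∀ y ∈ P e₁ e₂, y = z := by
    intro y hy
    obtain ⟨s₁, s₂, hs, y', hy', rfl⟩ := h.exists_pair hy hev
    obtain ⟨t₁, t₂, ht, z', hz', rfl⟩ := h.exists_pair hz hev
    obtain ⟨rfl, rfl⟩ := huniq _ _ hs ⟨y', hy'⟩
    obtain ⟨rfl, rfl⟩ := huniq _ _ ht ⟨z', hz'⟩
    congr 1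
    refine h.diag ?_ ?_ hy' hz' <;>
    · rcases hcase with ⟨rfl, rfl | rfl, rfl, rfl | rfl⟩ | ⟨rfl, rfl | rfl, rfl, rfl | rfl⟩ <;>
        omega
  -- A second contact point needs a direction `g ≠ e`, again through `c'`. Now `c'` lies on the side
  -- `e` and still has room towards `f`, so `g` must have component `-f`.
  obtain ⟨g₁, g₂, hg0, hag, y, hy, hyz⟩ := h.nonfragile ha z
  have hge : ¬ (g₁ = e₁ ∧ g₂ = e₂) := by
    rintro ⟨rfl, rfl⟩
    exact hyz (hsub y hy)
  obtain ⟨s₁, s₂, hs, y', hy', -⟩ := h.exists_pair hy (hvia g₁ g₂ hg0 hag)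
  have hs' := h.digit hs
  have hgr := h.range ⟨y, hy⟩
  have hsr := h.range ⟨y', hy'⟩
  -- so `c'` is the corner digit in direction `e - f`, and the one in direction `-e-f` is in `D`
  refine hcon.1 (h.corner (e₁ := e₁ + f₁) (e₂ := e₂ + f₂) ?_ ?_ hTf ?_ ?_)
  · rcases hcase with ⟨rfl, rfl | rfl, rfl, rfl | rfl⟩ | ⟨rfl, rfl | rfl, rfl, rfl | rfl⟩ <;> simp
  · rcases hcase with ⟨rfl, rfl | rfl, rfl, rfl | rfl⟩ | ⟨rfl, rfl | rfl, rfl, rfl | rfl⟩ <;> simp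
  all_goals
    have h1 : g₁ = -1 ∨ g₁ = 0 ∨ g₁ = 1 := by omega
    have h2 : g₂ = -1 ∨ g₂ = 0 ∨ g₂ = 1 := by omega
    rcases hcase with ⟨rfl, rfl | rfl, rfl, rfl | rfl⟩ | ⟨rfl, rfl | rfl, rfl, rfl | rfl⟩ <;>
      rcases h1 with rfl | rfl | rfl <;> rcases h2 with rfl | rfl | rfl <;> omega

/-- Let `c`, `cc'`, `cc'c''` be nested cells.  It is impossible that all contacts of `c` with its
siblings take place in `cc'` and, moreover, that all contacts of `cc'` with its siblings, or all
contacts of `cc'` with cells outside of `c`, take place in `cc'c''`. -/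
theorem not_nested (h : ContactSystem N D P φ) {a₁ a₂ c₁ c₂ b₁ b₂ : ℤ} (ha : D a₁ a₂)
    (hc : D c₁ c₂)
    (hvia : ∀ e₁ e₂, (e₁ ≠ 0 ∨ e₂ ≠ 0) → D (a₁ + e₁) (a₂ + e₂) → OnlyVia N D P e₁ e₂ c₁ c₂)
    (hvia' : (∀ e₁ e₂, (e₁ ≠ 0 ∨ e₂ ≠ 0) → D (c₁ + e₁) (c₂ + e₂) → OnlyVia N D P e₁ e₂ b₁ b₂) ∨
      (∀ e₁ e₂, (e₁ ≠ 0 ∨ e₂ ≠ 0) → D (a₁ + e₁) (a₂ + e₂) → ∀ d₁ d₂, D d₁ d₂ →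
        OnlyVia N D P (N * e₁ + d₁ - c₁) (N * e₂ + d₂ - c₂) b₁ b₂)) : False := by
  have hN := h.two_le
  have hc' := h.digit hc
  obtain ⟨e₁, e₂, f₁, f₂, hcase, hae, hTe, hTf, hdf, hor⟩ := h.exists_two_pairs ha hc hvia
  have he0 : e₁ ≠ 0 ∨ e₂ ≠ 0 := by omega
  have hev := hvia e₁ e₂ he0 hae
  have hdf' := h.digit hdf
  have hT : ∀ {a b a' b' : ℤ}, (P a b).Nonempty → a' = a → b' = b → (P a' b').Nonempty := by
    rintro a b _ _ hab rfl rfl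
    exact hab
  rcases hvia' with hin | hout
  · -- the cells next to `c'` in the directions `f` and `-f` are absent
    have hplus : ¬ D (c₁ + f₁) (c₂ + f₂) := by
      intro hD
      have := hev _ _ _ _ hD hdf (hT hTe (by ring) (by ring))
      omega
    have hminus : ¬ D (c₁ - f₁) (c₂ - f₂) := by
      intro hD
      rcases hor with hd | ⟨-, hd⟩
      · have := hev _ _ _ _ hD hd (hT hTf (by ring) (by ring))
        omega
      · have := hev _ _ _ _ hD hd (hT hTe (by ring) (by ring))
        omega
    -- No sibling lies beyond `c'` towards `e`, and `f`, `-f` were just excluded. The direction `-e`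
    -- fails because the two pairs across `e`, read backwards, would make contact in two different
    -- subcells. Two diagonals remain.
    have hsib : ∀ g₁ g₂, (g₁ ≠ 0 ∨ g₂ ≠ 0) → D (c₁ + g₁) (c₂ + g₂) → (P g₁ g₂).Nonempty →
        (g₁ = -e₁ + f₁ ∧ g₂ = -e₂ + f₂) ∨ (g₁ = -e₁ - f₁ ∧ g₂ = -e₂ - f₂) := by
      intro g₁ g₂ hg0 hcg hTg
      have hgr := h.range hTg
      have hcg' := h.digit hcg
      have h1 : ¬ (g₁ = f₁ ∧ g₂ = f₂) := by
        rintro ⟨rfl, rfl⟩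
        exact hplus hcg
      have h2 : ¬ (g₁ = -f₁ ∧ g₂ = -f₂) := by
        rintro ⟨rfl, rfl⟩
        exact hminus hcg
      have h3 : ¬ (g₁ = -e₁ ∧ g₂ = -e₂) := by
        rintro ⟨rfl, rfl⟩
        have hv := hin _ _ hg0 hcg
        have h4 := hv _ _ _ _ hdf hc (hT (h.neg hTf) (by ring) (by ring))
        rcases hor with hd | ⟨hTm, hd⟩
        · have h5 := hv _ _ _ _ hd hc (hT (h.neg hTe) (by ring) (by ring))
          omega
        · have h5 := hv _ _ _ _ hd hc (hT (h.neg hTm) (by ring) (by ring))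
          omega
      rcases hcase with ⟨rfl, rfl | rfl, rfl, rfl | rfl⟩ | ⟨rfl, rfl | rfl, rfl, rfl | rfl⟩ <;>
        omega
    -- A diagonal contact is one point, so non-fragility requires both diagonals. They force `b`
    -- into two different corners.
    obtain ⟨g₁, g₂, hg0, hcg, z, hz, -⟩ := h.nonfragile hc (0, 0)
    obtain ⟨k₁, k₂, hk0, hck, y, hy, hyz⟩ := h.nonfragile hc z
    have hg := hsib g₁ g₂ hg0 hcg ⟨z, hz⟩
    have hk := hsib k₁ k₂ hk0 hck ⟨y, hy⟩
    have hgk : ¬ (k₁ = g₁ ∧ k₂ = g₂) := by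
      rintro ⟨rfl, rfl⟩
      refine hyz (h.diag ?_ ?_ hy hz) <;> omega
    obtain ⟨s₁, s₂, hs, z', hz', -⟩ := h.exists_pair hz (hin g₁ g₂ hg0 hcg)
    obtain ⟨t₁, t₂, ht, y', hy', -⟩ := h.exists_pair hy (hin k₁ k₂ hk0 hck)
    have h1 := h.range ⟨z', hz'⟩
    have h2 := h.range ⟨y', hy'⟩
    have h3 := h.digit hs
    have h4 := h.digit ht
    rcases hg with ⟨rfl, rfl⟩ | ⟨rfl, rfl⟩ <;> rcases hk with ⟨rfl, rfl⟩ | ⟨rfl, rfl⟩ <;>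
      rcases hcase with ⟨rfl, rfl | rfl, rfl, rfl | rfl⟩ | ⟨rfl, rfl | rfl, rfl, rfl | rfl⟩ <;>
        omega
  -- The contact with offset `e + f` puts `b` in that corner. A second pair with offset `e` gives `b
  -- = c'`, which still has room towards `f`; one with offset `e - f` puts `b` in another corner.
  · have hvf := hout e₁ e₂ he0 hae _ _ hdf
    rw [show N * e₁ + (c₁ - (N - 1) * e₁ + f₁) - c₁ = e₁ + f₁ by ring,
      show N * e₂ + (c₂ - (N - 1) * e₂ + f₂) - c₂ = e₂ + f₂ by ring] at hvf
    obtain ⟨z, hz⟩ := hTf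
    obtain ⟨s₁, s₂, hs, z', hz', -⟩ := h.exists_pair hz hvf
    have h1 := h.range ⟨z', hz'⟩
    have h3 := h.digit hs
    rcases hor with hd | ⟨⟨y, hy⟩, hd⟩
    · have hv := hout e₁ e₂ he0 hae _ _ hd
      rw [show N * e₁ + (c₁ - (N - 1) * e₁) - c₁ = e₁ by ring,
        show N * e₂ + (c₂ - (N - 1) * e₂) - c₂ = e₂ by ring] at hv
      obtain ⟨rfl, rfl⟩ := hv _ _ _ _ hc hd (hT hTe (by ring) (by ring))
      rcases hcase with ⟨rfl, rfl | rfl, rfl, rfl | rfl⟩ | ⟨rfl, rfl | rfl, rfl, rfl | rfl⟩ <;>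
        omega
    · have hv := hout e₁ e₂ he0 hae _ _ hd
      rw [show N * e₁ + (c₁ - (N - 1) * e₁ - f₁) - c₁ = e₁ - f₁ by ring,
        show N * e₂ + (c₂ - (N - 1) * e₂ - f₂) - c₂ = e₂ - f₂ by ring] at hv
      obtain ⟨t₁, t₂, ht, y', hy', -⟩ := h.exists_pair hy hv
      have h2 := h.range ⟨y', hy'⟩
      have h4 := h.digit ht
      rcases hcase with ⟨rfl, rfl | rfl, rfl, rfl | rfl⟩ | ⟨rfl, rfl | rfl, rfl, rfl | rfl⟩ <;>
        omega

end ContactSystem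

section Contact

variable {N : ℕ} {D : Finset (Fin N × Fin N)}

/-! ### The contact system of a carpet -/

/-- `(a, b)` is a digit of `D`. -/
def IsDigit (D : Finset (Fin N × Fin N)) (a b : ℤ) : Prop :=
  ∃ i ∈ D, ((i.1 : ℕ) : ℤ) = a ∧ ((i.2 : ℕ) : ℤ) = b

/-- The intersection of the carpet with its translate by `(a, b)`. -/
def contact (D : Finset (Fin N × Fin N)) (a b : ℤ) : Set (ℝ × ℝ) :=
  {z | z ∈ gsc N D ∧ (z.1 - a, z.2 - b) ∈ gsc N D}

theorem isDigit_of_mem {i : Fin N × Fin N} (hi : i ∈ D) :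
    IsDigit D ((i.1 : ℕ) : ℤ) ((i.2 : ℕ) : ℤ) :=
  ⟨i, hi, rfl, rfl⟩

theorem digitMap_eq_iff (hN : 2 ≤ N) (i j : Fin N × Fin N) (y z : ℝ × ℝ) :
    digitMap i y = digitMap j z ↔
      y.1 + (i.1 : ℕ) = z.1 + (j.1 : ℕ) ∧ y.2 + (i.2 : ℕ) = z.2 + (j.2 : ℕ) := by
  have hN' : (N : ℝ) ≠ 0 := by positivity
  simp only [digitMap, Prod.mk.injEq, div_left_inj' hN']

theorem eq_of_val_eq {i j : Fin N × Fin N} (h₁ : ((i.1 : ℕ) : ℤ) = (j.1 : ℕ))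
    (h₂ : ((i.2 : ℕ) : ℤ) = (j.2 : ℕ)) : i = j :=
  Prod.ext (Fin.ext (by exact_mod_cast h₁)) (Fin.ext (by exact_mod_cast h₂))

/-- In a connected non-fragile carpet, each first-level cell has at least two points in common
with the union of the others. -/
theorem exists_contact_ne (hN : 2 ≤ N) (hD : 1 < D.card) (hconn : IsConnected (gsc N D))
    (hnf : ¬ IsFragile N D) {c : Fin N × Fin N} (hc : c ∈ D) (p : ℝ × ℝ) :
    ∃ a ∈ D, a ≠ c ∧ ∃ x ∈ digitMap c '' gsc N D, x ∈ digitMap a '' gsc N D ∧ x ≠ p := by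
  classical
  have hDne : D.Nonempty := ⟨c, hc⟩
  have hcpt := (isAttractor_gsc hN hDne).2.1
  set A := ⋃ i ∈ ({c} : Finset (Fin N × Fin N)), digitMap i '' gsc N D with hA
  set B := ⋃ i ∈ D.erase c, digitMap i '' gsc N D with hB
  have hAcl : IsClosed A :=
    (Finset.isCompact_biUnion _ fun i _ => hcpt.image (continuous_digitMap i)).isClosed
  have hBcl : IsClosed B :=
    (Finset.isCompact_biUnion _ fun i _ => hcpt.image (continuous_digitMap i)).isClosed
  have hsub : ∀ i ∈ D, ∀ x ∈ digitMap i '' gsc N D, x ∈ gsc N D := by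
    rintro i hi _ ⟨y, hy, rfl⟩
    exact digitMap_mem_gsc hN hi hy
  have hcov : gsc N D ⊆ A ∪ B := by
    intro x hx
    obtain ⟨i, hi, y, hy, rfl⟩ := (mem_gsc_iff hN hDne).1 hx
    by_cases hic : i = c
    · exact Or.inl (Set.mem_biUnion (by simpa using hic) ⟨y, hy, rfl⟩)
    · exact Or.inr (Set.mem_biUnion (Finset.mem_coe.2 (Finset.mem_erase.2 ⟨hic, hi⟩)) ⟨y, hy, rfl⟩)
  obtain ⟨z, hz⟩ := hconn.nonempty
  obtain ⟨a, ha, hac⟩ := Finset.exists_mem_ne hD c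
  obtain ⟨x, -, hxA, hxB⟩ := isPreconnected_closed_iff.1 hconn.isPreconnected A B hAcl hBcl hcov
    ⟨digitMap c z, digitMap_mem_gsc hN hc hz, Set.mem_biUnion (by simp) ⟨z, hz, rfl⟩⟩
    ⟨digitMap a z, digitMap_mem_gsc hN ha hz,
      Set.mem_biUnion (Finset.mem_coe.2 (Finset.mem_erase.2 ⟨hac, ha⟩)) ⟨z, hz, rfl⟩⟩
  have hex : ∃ y ∈ A ∩ B, y ≠ p := by
    by_contra hcon
    push Not at hcon
    refine hnf ⟨{c}, D.erase c, ?_, ?_, p, ?_⟩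
    · rw [← Finset.insert_eq, Finset.insert_erase hc]
    · simp
    · ext y
      constructor
      · exact fun hy => hcon y hy
      · rintro rfl
        rw [← hcon x ⟨hxA, hxB⟩]
        exact ⟨hxA, hxB⟩
  obtain ⟨y, ⟨hyA, hyB⟩, hyp⟩ := hex
  simp only [hA, hB, Finset.mem_singleton, Set.iUnion_iUnion_eq_left, Set.mem_iUnion,
    Finset.mem_erase, exists_prop] at hyA hyB
  obtain ⟨b, ⟨hbc, hb⟩, hyb⟩ := hyB
  exact ⟨b, hb, hbc, y, hyA, hyb, hyp⟩

/-- Subdividing `F` and its translate by `e` turns a contact into one between subcells `c` and `d`;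
rescaled by `N`, its offset is `N e + d - c`. -/
theorem contactSystem_gsc (hN : 2 ≤ N) (hD : 1 < D.card) (hconn : IsConnected (gsc N D))
    (hnf : ¬ IsFragile N D) : ContactSystem N (IsDigit D) (contact D)
      fun a b z => ((z.1 + a) / N, (z.2 + b) / N) where
  two_le := by exact_mod_cast hN
  digit := by
    rintro _ _ ⟨i, -, rfl, rfl⟩
    have h1 := i.1.2
    have h2 := i.2.2
    omega
  range := by
    rintro a b ⟨z, hz, hz'⟩
    have h1 := gsc_bounds hz
    have h2 := gsc_bounds hz'
    have h3 : (-1 : ℝ) ≤ a ∧ (a : ℝ) ≤ 1 ∧ (-1 : ℝ) ≤ b ∧ (b : ℝ) ≤ 1 := by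
      refine ⟨?_, ?_, ?_, ?_⟩ <;> linarith
    exact_mod_cast h3
  neg := by
    rintro a b ⟨z, hz, hz'⟩
    exact ⟨_, hz', by simpa using hz⟩
  up := by
    rintro e₁ e₂ _ _ _ _ ⟨c, hc, rfl, rfl⟩ ⟨d, hd, rfl, rfl⟩ ⟨z, hz, hz'⟩
    refine ⟨digitMap c z, digitMap_mem_gsc hN hc hz, ?_⟩
    convert digitMap_mem_gsc hN hd hz' using 1
    simp only [digitMap, Prod.mk.injEq]
    push_cast
    constructor <;> field_simp <;> ring
  down := by
    rintro e₁ e₂ z ⟨hz, hz'⟩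
    have hDne : D.Nonempty := Finset.card_pos.1 (by omega)
    obtain ⟨c, hc, y, hy, rfl⟩ := (mem_gsc_iff hN hDne).1 hz
    obtain ⟨d, hd, t, ht, hdt⟩ := (mem_gsc_iff hN hDne).1 hz'
    refine ⟨_, _, _, _, isDigit_of_mem hc, isDigit_of_mem hd, y, ⟨hy, ?_⟩, by simp [digitMap]⟩
    convert ht using 1
    simp only [digitMap, Prod.mk.injEq] at hdt
    obtain ⟨h1, h2⟩ := hdt
    field_simp at h1 h2
    ext
    · push_cast
      linarith
    · push_cast
      linarith
  fixed := by
    rintro _ _ ⟨c, hc, rfl, rfl⟩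
    have hN1 : (N : ℝ) - 1 ≠ 0 := by
      have : (2 : ℝ) ≤ N := by exact_mod_cast hN
      linarith
    have hN0 : (N : ℝ) ≠ 0 := by positivity
    -- The fixed point of the map with digit `c`. Applying the hypothesis `n` times brings every
    -- contact point within a constant times `N^(-n)` of it.
    set κ : ℝ × ℝ := (((c.1 : ℕ) : ℝ) / (N - 1), ((c.2 : ℕ) : ℝ) / (N - 1)) with hκ
    have hκfix : digitMap c κ = κ := by
      simp only [digitMap, hκ, Prod.mk.injEq]
      constructor <;> field_simp <;> ring
    refine ⟨κ, fun e₁ e₂ h z hz => ?_⟩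
    have hbd : ∀ n : ℕ, ∀ z ∈ contact D e₁ e₂, dist z κ ≤ (1 + dist (0 : ℝ × ℝ) κ) * (1 / N) ^ n := by
      intro n
      induction n with
      | zero =>
        intro z hz
        have h0 : dist z 0 ≤ 1 := by
          have := gsc_bounds hz.1
          rw [Prod.dist_eq, Real.dist_eq, Real.dist_eq]
          refine max_le ?_ ?_ <;> rw [abs_le] <;> constructor <;> simp <;> linarith
        rw [pow_zero, mul_one]
        linarith [dist_triangle z 0 κ]
      | succ n ih =>
        intro z hz
        obtain ⟨z', hz', hzz⟩ := h z hz
        have : z = digitMap c z' := by rw [hzz]; simp [digitMap]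
        rw [this, ← hκfix, dist_digitMap, hκfix, pow_succ, ← mul_assoc, mul_one_div]
        gcongr
        exact ih z' hz'
    have hlt : (1 : ℝ) / N < 1 := by
      rw [div_lt_one (by positivity)]
      exact_mod_cast hN
    have hlim := (tendsto_pow_atTop_nhds_zero_of_lt_one (by positivity) hlt).const_mul
      (1 + dist (0 : ℝ × ℝ) κ)
    rw [mul_zero] at hlim
    exact dist_le_zero.1 (ge_of_tendsto' hlim fun n => hbd n z hz)
  diag := by
    rintro e₁ e₂ z z' he₁ he₂ ⟨hz, hze⟩ ⟨hz', hze'⟩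
    -- For `e ≠ 0` the intervals `[0, 1]` and `[e, e + 1]` share at most one point.
    have key : ∀ (e : ℤ) (a b : ℝ), e ≠ 0 → 0 ≤ a → a ≤ 1 → 0 ≤ a - e → a - e ≤ 1 → 0 ≤ b →
        b ≤ 1 → 0 ≤ b - e → b - e ≤ 1 → a = b := by
      intro e a b he h1 h2 h3 h4 h5 h6 h7 h8
      rcases lt_or_gt_of_ne he with he | he
      · have : (e : ℝ) ≤ -1 := by exact_mod_cast Int.le_sub_one_of_lt he
        linarith
      · have : (1 : ℝ) ≤ e := by exact_mod_cast he
        linarith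
    have h1 := gsc_bounds hz
    have h2 := gsc_bounds hz'
    have h3 := gsc_bounds hze
    have h4 := gsc_bounds hze'
    simp only at h3 h4
    exact Prod.ext (key e₁ _ _ he₁ h1.1 h1.2.1 h3.1 h3.2.1 h2.1 h2.2.1 h4.1 h4.2.1)
      (key e₂ _ _ he₂ h1.2.2.1 h1.2.2.2 h3.2.2.1 h3.2.2.2 h2.2.2.1 h2.2.2.2 h4.2.2.1 h4.2.2.2)
  nonfragile := by
    rintro _ _ ⟨c, hc, rfl, rfl⟩ p
    obtain ⟨a, ha, hac, _, ⟨z, hz, rfl⟩, ⟨y, hy, hyz⟩, hne⟩ :=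
      exists_contact_ne hN hD hconn hnf hc (digitMap c p)
    rw [digitMap_eq_iff hN] at hyz
    refine ⟨((a.1 : ℕ) : ℤ) - (c.1 : ℕ), ((a.2 : ℕ) : ℤ) - (c.2 : ℕ), ?_, ?_, z, ⟨hz, ?_⟩, ?_⟩
    · by_contra hcon
      push Not at hcon
      exact hac (eq_of_val_eq (by linarith [hcon.1]) (by linarith [hcon.2]))
    · simpa using isDigit_of_mem ha
    · convert hy using 1
      ext
      · push_cast
        linarith [hyz.1]
      · push_cast
        linarith [hyz.2]
    · rintro rfl
      exact hne rfl

/-! ### Counting cells -/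

/-- The position of the cell of a word of length `k` in the grid of mesh `N ^ (-k)`. -/
def address : (k : ℕ) → (Fin k → D) → ℤ × ℤ
  | 0, _ => (0, 0)
  | k + 1, w => ((((w 0 : Fin N × Fin N).1 : ℕ) : ℤ) * (N : ℤ) ^ k + (address k (Fin.tail w)).1,
      (((w 0 : Fin N × Fin N).2 : ℕ) : ℤ) * (N : ℤ) ^ k + (address k (Fin.tail w)).2)

theorem wordMap_eq_address (hN : 2 ≤ N) (k : ℕ) (w : Fin k → D) (z : ℝ × ℝ) :
    wordMap k w z =
      ((z.1 + (address k w).1) / (N : ℝ) ^ k, (z.2 + (address k w).2) / (N : ℝ) ^ k) := by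
  have hN' : (N : ℝ) ≠ 0 := by positivity
  induction k with
  | zero => simp [wordMap, address]
  | succ k ih =>
    simp only [wordMap, Function.comp_apply, ih, digitMap, address, Prod.mk.injEq]
    push_cast
    constructor <;> field_simp <;> ring

theorem address_bounds (k : ℕ) (w : Fin k → D) :
    (0 ≤ (address k w).1 ∧ (address k w).1 < (N : ℤ) ^ k) ∧
      (0 ≤ (address k w).2 ∧ (address k w).2 < (N : ℤ) ^ k) := by
  induction k with
  | zero => simp [address]
  | succ k ih =>
    have key : ∀ (i : Fin N) (a : ℤ), 0 ≤ a → a < (N : ℤ) ^ k →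
        0 ≤ ((i : ℕ) : ℤ) * (N : ℤ) ^ k + a ∧ ((i : ℕ) : ℤ) * (N : ℤ) ^ k + a < (N : ℤ) ^ (k + 1) := by
      intro i a h0 h1
      have hi : ((i : ℕ) : ℤ) + 1 ≤ N := by exact_mod_cast i.2
      refine ⟨by positivity, ?_⟩
      calc ((i : ℕ) : ℤ) * (N : ℤ) ^ k + a < (((i : ℕ) : ℤ) + 1) * (N : ℤ) ^ k := by linarith
        _ ≤ N * (N : ℤ) ^ k := by gcongr
        _ = (N : ℤ) ^ (k + 1) := by ring
    obtain ⟨⟨h1, h2⟩, h3, h4⟩ := ih (Fin.tail w)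
    exact ⟨key _ _ h1 h2, key _ _ h3 h4⟩

theorem address_injective (k : ℕ) : Function.Injective (address (D := D) k) := by
  induction k with
  | zero => exact fun _ _ _ => Subsingleton.elim _ _
  | succ k ih =>
    have key : ∀ i j a b M : ℤ, 0 ≤ a → a < M → 0 ≤ b → b < M → i * M + a = j * M + b →
        i = j ∧ a = b := by
      intro i j a b M h1 h2 h3 h4 h
      have hi : (i * M + a) / M = i := by
        rw [Int.add_comm, Int.add_mul_ediv_right _ _ (by omega), Int.ediv_eq_zero_of_lt h1 h2,
          zero_add]
      have hj : (j * M + b) / M = j := by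
        rw [Int.add_comm, Int.add_mul_ediv_right _ _ (by omega), Int.ediv_eq_zero_of_lt h3 h4,
          zero_add]
      have hij : i = j := by rw [← hi, h, hj]
      subst hij
      exact ⟨rfl, by linarith⟩
    intro v w h
    simp only [address, Prod.mk.injEq] at h
    obtain ⟨⟨h1, h2⟩, h3, h4⟩ := address_bounds k (Fin.tail v)
    obtain ⟨⟨h5, h6⟩, h7, h8⟩ := address_bounds k (Fin.tail w)
    obtain ⟨e1, e2⟩ := key _ _ _ _ _ h1 h2 h5 h6 h.1
    obtain ⟨e3, e4⟩ := key _ _ _ _ _ h3 h4 h7 h8 h.2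
    rw [← Fin.cons_self_tail v, ← Fin.cons_self_tail w, ih (Prod.ext e2 e4),
      Subtype.ext (eq_of_val_eq e1 e3)]

open Classical in
/-- A point lies in at most four cells of a given level. -/
theorem card_filter_mem_cell_le (hN : 2 ≤ N) (k : ℕ) (x : ℝ × ℝ) :
    (Finset.univ.filter fun w : Fin k → D => x ∈ cell k w).card ≤ 4 := by
  -- In each coordinate, the address `a` of a cell containing `x` satisfies `t - 1 ≤ a ≤ t`, where
  -- `t` is the coordinate of `x` scaled by `N^k`.
  have key : ∀ t : ℝ, (Finset.Icc (⌈t⌉ - 1) ⌊t⌋).card ≤ 2 := by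
    intro t
    rw [Int.card_Icc]
    have := Int.floor_le_ceil t
    omega
  calc _ ≤ (Finset.Icc (⌈x.1 * (N : ℝ) ^ k⌉ - 1) ⌊x.1 * (N : ℝ) ^ k⌋ ×ˢ
        Finset.Icc (⌈x.2 * (N : ℝ) ^ k⌉ - 1) ⌊x.2 * (N : ℝ) ^ k⌋).card := by
        refine Finset.card_le_card_of_injOn (address k) ?_ (address_injective k).injOn
        intro w hw
        obtain ⟨y, hy, rfl⟩ : x ∈ cell k w := by simpa using hw
        obtain ⟨h1, h2, h3, h4⟩ := gsc_bounds hy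
        have hNk : (N : ℝ) ^ k ≠ 0 := by positivity
        simp only [wordMap_eq_address hN, div_mul_cancel₀ _ hNk, Finset.coe_product, Finset.coe_Icc,
          Set.mem_prod, Set.mem_Icc, Int.le_floor, sub_le_iff_le_add, Int.ceil_le]
        push_cast
        refine ⟨⟨?_, ?_⟩, ?_, ?_⟩ <;> linarith
    _ ≤ 2 * 2 := by
        rw [Finset.card_product]
        exact Nat.mul_le_mul (key _) (key _)

theorem wordMap_split {n l k : ℕ} (h : k = n + l) (w : Fin k → D) :
    wordMap k w = wordMap n (fun i => w ⟨i, by omega⟩) ∘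
      wordMap l (fun j => w ⟨n + j, by omega⟩) := by
  induction n generalizing k with
  | zero =>
    obtain rfl : k = l := by omega
    simp only [wordMap, Function.id_comp]
    congr 1
    ext j : 1
    congr 1
    ext
    simp
  | succ n ih =>
    obtain ⟨k, rfl⟩ : ∃ k', k = k' + 1 := ⟨n + l, by omega⟩
    simp only [wordMap, Function.comp_assoc]
    congr 1
    rw [ih (by omega) (Fin.tail w)]
    congr 2
    ext j : 1
    simp only [Fin.tail]
    congr 1
    ext
    simp
    omega

theorem cell_subset_prefix (hN : 2 ≤ N) {n k : ℕ} (h : n ≤ k) (w : Fin k → D) :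
    cell k w ⊆ cell n fun i => w ⟨i, by omega⟩ := by
  obtain ⟨l, rfl⟩ := Nat.exists_eq_add_of_le h
  rw [cell, wordMap_split rfl w, Set.image_comp]
  exact Set.image_mono (cell_subset hN l _)

/-- A set of more than `4 |D| ^ (k - n)` words of length `k` contains a word whose prefix of length
`n` has a cell that avoids a given point. -/
theorem exists_prefix_notMem (hN : 2 ≤ N) {n k : ℕ} (h : n ≤ k) (S : Set (Fin k → D))
    (hS : 4 * D.card ^ (k - n) < S.ncard) (x : ℝ × ℝ) :
    ∃ w ∈ S, x ∉ cell n fun i => w ⟨i, by omega⟩ := by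
  classical
  by_contra hcon
  push Not at hcon
  obtain ⟨l, rfl⟩ := Nat.exists_eq_add_of_le h
  rw [Nat.add_sub_cancel_left] at hS
  refine absurd hS (not_lt.2 ?_)
  -- A word is determined by its prefix and suffix; if every prefix cell contained `x`, at most four
  -- prefixes and `|D|^l` suffixes would be available.
  set T := Finset.univ.filter fun u : Fin n → D => x ∈ cell n u
  calc S.ncard ≤ ((T ×ˢ (Finset.univ : Finset (Fin l → D)) :
        Finset ((Fin n → D) × (Fin l → D))) : Set ((Fin n → D) × (Fin l → D))).ncard := by
        refine Set.ncard_le_ncard_of_injOn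
          (fun w : Fin (n + l) → D => ((fun i => w ⟨i, by omega⟩ : Fin n → D),
            (fun j => w ⟨n + j, by omega⟩ : Fin l → D))) ?_ ?_
        · intro w hw
          simpa [T] using hcon w hw
        · intro v _ w _ hvw
          simp only [Prod.mk.injEq] at hvw
          ext i : 1
          by_cases hi : (i : ℕ) < n
          · exact congrFun hvw.1 ⟨i, hi⟩
          · convert congrFun hvw.2 ⟨i - n, by omega⟩ using 2 <;>
            · ext
              simp
              omega
    _ = T.card * D.card ^ l := by
        rw [Set.ncard_coe_finset, Finset.card_product]
        simp
    _ ≤ 4 * D.card ^ l := Nat.mul_le_mul_right _ (card_filter_mem_cell_le hN n x)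

/-! ### From Hata graphs to cut points -/

/-- If `χ(Γ_k) ≥ |D| ^ (k - 1)`, a cell of level `k` separates the carpet into two large parts. -/
theorem exists_separating_cell (hN : 2 ≤ N) (hD : 1 < D.card) (hconn : IsConnected (gsc N D))
    {k : ℕ} (hk : 4 ≤ k) (hchi : D.card ^ (k - 1) ≤ chi (hataGraph N D k)) :
    ∃ (v : Fin k → D) (A B : Set (ℝ × ℝ)), IsClosed A ∧ IsClosed B ∧ Disjoint A B ∧
      gsc N D ⊆ A ∪ B ∪ cell k v ∧
      (∀ x, ∃ u : Fin 4 → D, x ∉ cell 4 u ∧ (cell 4 u ∩ A).Nonempty) ∧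
      (∀ x, ∃ u : Fin 4 → D, x ∉ cell 4 u ∧ (cell 4 u ∩ B).Nonempty) := by
  have hDne : D.Nonempty := Finset.card_pos.1 (by omega)
  have hcpt := (isAttractor_gsc hN hDne).2.1
  obtain ⟨v, C, C', hne, hC, hC'⟩ := (le_chi_iff _ (by positivity)).1 hchi
  set S : Set (Fin k → D) := Subtype.val '' C.supp with hS
  -- All components other than `C`, including `C'`, are lumped together, so that `S`, `S'` and `v`
  -- exhaust the words.
  set S' : Set (Fin k → D) := {w | w ∉ S ∧ w ≠ v} with hS'
  have hcl : ∀ T : Set (Fin k → D), IsClosed (⋃ w ∈ T, cell k w) := fun T =>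
    T.toFinite.isClosed_biUnion fun w _ => (isCompact_cell hcpt k w).isClosed
  have hlarge : ∀ T : Set (Fin k → D), D.card ^ (k - 1) ≤ T.ncard → ∀ x, ∃ u : Fin 4 → D,
      x ∉ cell 4 u ∧ (cell 4 u ∩ ⋃ w ∈ T, cell k w).Nonempty := by
    intro T hT x
    -- This is why level 4 is used: `|D|^3 ≥ 8 > 4`, while level 3 would only give `|D|^2 ≥ 4`.
    have hlt : 4 * D.card ^ (k - 4) < T.ncard := by
      refine lt_of_lt_of_le ?_ hT
      rw [show k - 1 = (k - 4) + 3 by omega, pow_add, mul_comm]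
      refine Nat.mul_lt_mul_of_pos_left ?_ (by positivity)
      calc 4 < 2 ^ 3 := by norm_num
        _ ≤ D.card ^ 3 := Nat.pow_le_pow_left hD 3
    obtain ⟨w, hw, hxw⟩ := exists_prefix_notMem hN hk T hlt x
    obtain ⟨z, hz⟩ := cell_nonempty hconn.nonempty k w
    exact ⟨_, hxw, z, cell_subset_prefix hN hk w hz, Set.mem_biUnion hw hz⟩
  refine ⟨v, ⋃ w ∈ S, cell k w, ⋃ w ∈ S', cell k w, hcl S, hcl S', ?_, ?_,
    hlarge S ?_, hlarge S' ?_⟩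
  · rw [Set.disjoint_left]
    intro x hx hx'
    simp only [Set.mem_iUnion, exists_prop] at hx hx'
    obtain ⟨_, ⟨a, ha, rfl⟩, hxa⟩ := hx
    obtain ⟨b, ⟨hbS, hbv⟩, hxb⟩ := hx'
    have hadj : (deleteVertex (hataGraph N D k) v).Adj a ⟨b, hbv⟩ := by
      refine ⟨?_, x, hxa, hxb⟩
      rintro hab
      exact hbS ⟨a, ha, hab⟩
    exact hbS ⟨⟨b, hbv⟩, (C.mem_supp_congr_adj hadj).1 ha, rfl⟩
  · intro x hx
    obtain ⟨w, hw⟩ := exists_mem_cell hN hDne k hx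
    by_cases hwv : w = v
    · exact Or.inr (hwv ▸ hw)
    · by_cases hwS : w ∈ S
      · exact Or.inl (Or.inl (Set.mem_biUnion hwS hw))
      · exact Or.inl (Or.inr (Set.mem_biUnion (show w ∈ S' from ⟨hwS, hwv⟩) hw))
  · rwa [hS, Set.ncard_image_of_injective _ Subtype.val_injective]
  · refine hC'.trans ?_
    rw [← Set.ncard_image_of_injective C'.supp Subtype.val_injective]
    refine Set.ncard_le_ncard ?_ (Set.toFinite _)
    rintro _ ⟨b, hb, rfl⟩
    refine ⟨?_, b.2⟩
    rintro ⟨a, ha, hab⟩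
    obtain rfl := Subtype.val_injective hab
    exact hne (ha.symm.trans hb)

/-- Small connected closed neighbourhoods in a connected carpet. -/
theorem exists_connected_nhd (hN : 2 ≤ N) (hD : D.Nonempty) (hconn : IsConnected (gsc N D))
    {y x : ℝ × ℝ} (hyx : y ≠ x) :
    ∃ K O : Set (ℝ × ℝ), IsOpen O ∧ y ∈ O ∧ gsc N D ∩ O ⊆ K ∧ K ⊆ gsc N D ∧ IsClosed K ∧
      IsPreconnected K ∧ x ∉ K := by
  have hcpt := (isAttractor_gsc hN hD).2.1
  have hcl : ∀ n (T : Set (Fin n → D)), IsClosed (⋃ w ∈ T, cell n w) := fun n T =>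
    T.toFinite.isClosed_biUnion fun w _ => (isCompact_cell hcpt n w).isClosed
  have hN1 : 1 / (N : ℝ) < 1 := by
    rw [div_lt_one (by positivity)]
    exact_mod_cast hN
  obtain ⟨n, hn⟩ := exists_pow_lt_of_lt_one (dist_pos.2 hyx) hN1
  rw [one_div_pow] at hn
  -- `K` is the union of the level-`n` cells through `y`, connected because they share `y`; `O` is
  -- the complement of the other cells. The cells are too small to reach `x`.
  refine ⟨⋃ w ∈ {w : Fin n → D | y ∈ cell n w}, cell n w,
    (⋃ w ∈ {w : Fin n → D | y ∉ cell n w}, cell n w)ᶜ, (hcl _ _).isOpen_compl, ?_, ?_, ?_,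
    hcl _ _, ?_, ?_⟩
  · simp
  · rintro z ⟨hz, hzO⟩
    obtain ⟨w, hw⟩ := exists_mem_cell hN hD n hz
    simp only [Set.mem_ofPred_eq, Set.mem_compl_iff, Set.mem_iUnion, not_exists] at hzO
    by_cases hy : y ∈ cell n w
    · exact Set.mem_biUnion (show w ∈ {w : Fin n → D | y ∈ cell n w} from hy) hw
    · exact absurd hw (hzO w hy)
  · exact Set.iUnion₂_subset fun w _ => cell_subset hN n w
  · rw [← Set.sUnion_image]
    refine isPreconnected_sUnion y _ ?_ ?_
    · rintro _ ⟨w, hw, rfl⟩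
      exact hw
    · rintro _ ⟨w, hw, rfl⟩
      exact (isConnected_cell hconn n w).isPreconnected
  · simp only [Set.mem_ofPred_eq, Set.mem_iUnion, not_exists]
    intro w hy hx
    exact absurd (dist_le_of_mem_cell hy hx) (not_le.2 hn)

/-- A non-principal ultrafilter replaces successive passages to subsequences: it selects the limit
`x` and, at once, a side for every connected closed set missing `x`. -/
theorem exists_isCutPoint_of_chi (hN : 2 ≤ N) (hD : 1 < D.card) (hconn : IsConnected (gsc N D))
    {k₀ : ℕ} (hchi : ∀ k, k₀ ≤ k → D.card ^ (k - 1) ≤ chi (hataGraph N D k)) :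
    ∃ x, IsCutPoint (gsc N D) x := by
  have hDne : D.Nonempty := Finset.card_pos.1 (by omega)
  have hcpt := (isAttractor_gsc hN hDne).2.1
  choose v A B hA hB hAB hcov hAl hBl using fun n : ℕ =>
    exists_separating_cell hN hD hconn (k := 4 + k₀ + n) (by omega) (hchi _ (by omega))
  choose p hp using fun n => cell_nonempty hconn.nonempty _ (v n)
  obtain ⟨x, hxF, hx⟩ := hcpt.ultrafilter_le_nhds' ((hyperfilter ℕ).map p)
    (Ultrafilter.mem_map.2 (univ_mem' fun n => cell_subset hN _ _ (hp n)))
  have hlim : Tendsto p (hyperfilter ℕ) (𝓝 x) := hx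
  have hmesh : Tendsto (fun n : ℕ => 1 / (N : ℝ) ^ (4 + k₀ + n)) (hyperfilter ℕ) (𝓝 0) := by
    have hN1 : (1 : ℝ) / N < 1 := by
      rw [div_lt_one (by positivity)]
      exact_mod_cast hN
    have h0 := tendsto_pow_atTop_nhds_zero_of_lt_one (by positivity) hN1
    have h1 := h0.comp (tendsto_add_atTop_nat (4 + k₀))
    refine (h1.congr fun n => ?_).mono_left (Nat.hyperfilter_le_atTop)
    rw [Function.comp_apply, one_div_pow, add_comm]
  have hside : ∀ K : Set (ℝ × ℝ), K ⊆ gsc N D → IsClosed K → IsPreconnected K → x ∉ K →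
      (∀ᶠ n in hyperfilter ℕ, K ⊆ A n) ∨ (∀ᶠ n in hyperfilter ℕ, K ⊆ B n) := by
    intro K hK hKcl hKconn hxK
    rw [← Ultrafilter.eventually_or]
    obtain ⟨ε, hε, hball⟩ := Metric.isOpen_iff.1 hKcl.isOpen_compl x hxK
    filter_upwards [hlim.eventually (Metric.ball_mem_nhds x (half_pos hε)),
      hmesh.eventually (gt_mem_nhds (half_pos hε))] with n hn1 hn2
    have hdisj : ∀ z ∈ K, z ∉ cell (4 + k₀ + n) (v n) := by
      intro z hz hzv
      refine hball ?_ hz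
      have h1 := dist_le_of_mem_cell hzv (hp n)
      have h2 := dist_triangle z (p n) x
      rw [Metric.mem_ball]
      linarith
    have hsub : K ⊆ A n ∪ B n := fun z hz => (hcov n (hK hz)).resolve_right (hdisj z hz)
    refine isPreconnected_iff_subset_of_disjoint_closed.1 hKconn _ _ (hA n) (hB n) hsub ?_
    rw [(hAB n).inter_eq, Set.inter_empty]
  have hexcl : ∀ y, (∀ᶠ n in hyperfilter ℕ, y ∈ A n) → ¬ ∀ᶠ n in hyperfilter ℕ, y ∈ B n := by
    intro y h1 h2
    obtain ⟨n, hn1, hn2⟩ := (h1.and h2).exists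
    exact Set.disjoint_left.1 (hAB n) hn1 hn2
  -- Eventual membership in `E n` need not define an open set, so it is required on a whole relative
  -- neighbourhood; `exists_connected_nhd` shows that this still covers `F \ {x}`.
  have hopen : ∀ E : ℕ → Set (ℝ × ℝ), IsOpen
      {z | ∃ O, IsOpen O ∧ z ∈ O ∧ ∀ y ∈ gsc N D ∩ O, ∀ᶠ n in hyperfilter ℕ, y ∈ E n} := by
    intro E
    rw [isOpen_iff_forall_mem_open]
    rintro z ⟨O, hO, hz, h⟩
    exact ⟨O, fun t ht => ⟨O, hO, ht, h⟩, hO, hz⟩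
  have hcover : gsc N D \ {x} ⊆
      {z | ∃ O, IsOpen O ∧ z ∈ O ∧ ∀ y ∈ gsc N D ∩ O, ∀ᶠ n in hyperfilter ℕ, y ∈ A n} ∪
      {z | ∃ O, IsOpen O ∧ z ∈ O ∧ ∀ y ∈ gsc N D ∩ O, ∀ᶠ n in hyperfilter ℕ, y ∈ B n} := by
    rintro y ⟨hy, hyx⟩
    obtain ⟨K, O, hO, hyO, hOK, hKF, hKcl, hKconn, hxK⟩ := exists_connected_nhd hN hDne hconn hyx
    rcases hside K hKF hKcl hKconn hxK with h | h
    · exact Or.inl ⟨O, hO, hyO, fun t ht => h.mono fun n hn => hn (hOK ht)⟩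
    · exact Or.inr ⟨O, hO, hyO, fun t ht => h.mono fun n hn => hn (hOK ht)⟩
  have hcell : ∀ u : Fin 4 → D, x ∉ cell 4 u →
      (∀ᶠ n in hyperfilter ℕ, cell 4 u ⊆ A n) ∨ (∀ᶠ n in hyperfilter ℕ, cell 4 u ⊆ B n) :=
    fun u hu => hside _ (cell_subset hN 4 u) (isCompact_cell hcpt 4 u).isClosed
      (isConnected_cell hconn 4 u).isPreconnected hu
  -- There are finitely many cells of level 4. If all those missing `x` were eventually in `B n`,
  -- one `n` would serve them all, although some cell missing `x` meets `A n`.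
  have hAex : ∃ u : Fin 4 → D, x ∉ cell 4 u ∧ ∀ᶠ n in hyperfilter ℕ, cell 4 u ⊆ A n := by
    by_contra hcon
    have hall : ∀ᶠ n in hyperfilter ℕ, ∀ u : Fin 4 → D, x ∉ cell 4 u → cell 4 u ⊆ B n := by
      rw [eventually_all]
      intro u
      by_cases hu : x ∈ cell 4 u
      · exact Eventually.of_forall fun n h => absurd hu h
      · exact ((hcell u hu).resolve_left fun h => hcon ⟨u, hu, h⟩).mono fun n hn _ => hn
    obtain ⟨n, hn⟩ := hall.exists
    obtain ⟨u, hu, z, hzu, hzA⟩ := hAl n x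
    exact Set.disjoint_left.1 (hAB n) hzA (hn u hu hzu)
  have hBex : ∃ u : Fin 4 → D, x ∉ cell 4 u ∧ ∀ᶠ n in hyperfilter ℕ, cell 4 u ⊆ B n := by
    by_contra hcon
    have hall : ∀ᶠ n in hyperfilter ℕ, ∀ u : Fin 4 → D, x ∉ cell 4 u → cell 4 u ⊆ A n := by
      rw [eventually_all]
      intro u
      by_cases hu : x ∈ cell 4 u
      · exact Eventually.of_forall fun n h => absurd hu h
      · exact ((hcell u hu).resolve_right fun h => hcon ⟨u, hu, h⟩).mono fun n hn _ => hn
    obtain ⟨n, hn⟩ := hall.exists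
    obtain ⟨u, hu, z, hzu, hzB⟩ := hBl n x
    exact Set.disjoint_left.1 (hAB n) (hn u hu hzu) hzB
  refine ⟨x, hxF, fun hpre => ?_⟩
  obtain ⟨a, hxa, ha⟩ := hAex
  obtain ⟨b, hxb, hb⟩ := hBex
  obtain ⟨s, hs⟩ := cell_nonempty hconn.nonempty 4 a
  obtain ⟨t, ht⟩ := cell_nonempty hconn.nonempty 4 b
  have hsF : s ∈ gsc N D \ {x} := ⟨cell_subset hN 4 a hs, fun h => hxa (h ▸ hs)⟩
  have htF : t ∈ gsc N D \ {x} := ⟨cell_subset hN 4 b ht, fun h => hxb (h ▸ ht)⟩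
  obtain ⟨y, ⟨hy, -⟩, ⟨O, -, hyO, hOA⟩, O', -, hyO', hOB⟩ :=
    hpre _ _ (hopen A) (hopen B) hcover
      ⟨s, hsF, (hcover hsF).resolve_right fun ⟨O, _, hsO, h⟩ =>
        hexcl s (ha.mono fun n hn => hn hs) (h s ⟨hsF.1, hsO⟩)⟩
      ⟨t, htF, (hcover htF).resolve_left fun ⟨O, _, htO, h⟩ =>
        hexcl t (h t ⟨htF.1, htO⟩) (hb.mono fun n hn => hn ht)⟩
  exact hexcl y (hOA y ⟨hy, hyO⟩) (hOB y ⟨hy, hyO'⟩)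

/-! ### Separations of the carpet by a point -/

/-- The open sets `u`, `v` induce a separation of `F \ {x}`. -/
structure Separation (N : ℕ) (D : Finset (Fin N × Fin N)) (x : ℝ × ℝ) (u v : Set (ℝ × ℝ)) :
    Prop where
  mem : x ∈ gsc N D
  isOpen_left : IsOpen u
  isOpen_right : IsOpen v
  cover : ∀ y ∈ gsc N D, y ≠ x → y ∈ u ∨ y ∈ v
  disjoint : ∀ y ∈ gsc N D, y ≠ x → y ∈ u → y ∉ v
  left : ∃ y ∈ gsc N D, y ≠ x ∧ y ∈ u
  right : ∃ y ∈ gsc N D, y ≠ x ∧ y ∈ v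

theorem IsCutPoint.exists_separation {x : ℝ × ℝ} (h : IsCutPoint (gsc N D) x) :
    ∃ u v, Separation N D x u v := by
  obtain ⟨hx, hn⟩ := h
  unfold IsPreconnected at hn
  push Not at hn
  obtain ⟨u, v, hu, hv, hcov, ⟨y, ⟨hy, hyx⟩, hyu⟩, ⟨z, ⟨hz, hzx⟩, hzv⟩, hdis⟩ := hn
  exact ⟨u, v, hx, hu, hv, fun t ht htx => hcov ⟨ht, htx⟩,
    fun t ht htx htu htv => Set.eq_empty_iff_forall_notMem.1 hdis t ⟨⟨ht, htx⟩, htu, htv⟩,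
    ⟨y, hy, hyx, hyu⟩, ⟨z, hz, hzx, hzv⟩⟩

theorem Separation.symm {x : ℝ × ℝ} {u v : Set (ℝ × ℝ)} (h : Separation N D x u v) :
    Separation N D x v u :=
  ⟨h.mem, h.isOpen_right, h.isOpen_left, fun y hy hyx => (h.cover y hy hyx).symm,
    fun y hy hyx hv hu => h.disjoint y hy hyx hu hv, h.right, h.left⟩

theorem Separation.subset_or_subset {x : ℝ × ℝ} {u v K : Set (ℝ × ℝ)}
    (h : Separation N D x u v) (hK : K ⊆ gsc N D) (hKc : IsPreconnected K) (hx : x ∉ K) :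
    K ⊆ u ∨ K ⊆ v := by
  have hne : ∀ y ∈ K, y ≠ x := fun y hy hyx => hx (hyx ▸ hy)
  refine isPreconnected_iff_subset_of_disjoint.1 hKc u v h.isOpen_left h.isOpen_right
    (fun y hy => h.cover y (hK hy) (hne y hy)) ?_
  rw [Set.eq_empty_iff_forall_notMem]
  rintro y ⟨hy, hyu, hyv⟩
  exact h.disjoint y (hK hy) (hne y hy) hyu hyv

/-- In a connected non-fragile carpet, any separation by a point restricts to a separation of some
first-level cell. -/
theorem Separation.exists_zoom (hN : 2 ≤ N) (hconn : IsConnected (gsc N D))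
    (hnf : ¬ IsFragile N D) {x : ℝ × ℝ} {u v : Set (ℝ × ℝ)} (h : Separation N D x u v) :
    ∃ c ∈ D, ∃ x', digitMap c x' = x ∧
      Separation N D x' (digitMap c ⁻¹' u) (digitMap c ⁻¹' v) := by
  classical
  have hDne : D.Nonempty := by
    obtain ⟨y, hy⟩ := hconn.nonempty
    rw [Finset.nonempty_iff_ne_empty]
    rintro rfl
    have := Set.mem_iInter.1 hy 1
    simp [pattern] at this
  have hcpt := (isAttractor_gsc hN hDne).2.1
  by_contra hcon
  push Not at hcon
  -- A cell containing `x` with further points on both sides would be the desired restriction; a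
  -- cell missing `x` is on one side by connectedness.
  have hmono : ∀ c ∈ D, (∀ y ∈ gsc N D, digitMap c y ≠ x → digitMap c y ∈ u) ∨
      (∀ y ∈ gsc N D, digitMap c y ≠ x → digitMap c y ∈ v) := by
    intro c hc
    by_cases hx : x ∈ digitMap c '' gsc N D
    · obtain ⟨x', hx', rfl⟩ := hx
      by_contra hn
      push Not at hn
      obtain ⟨⟨y, hy, hyx, hyu⟩, z, hz, hzx, hzv⟩ := hn
      have hinj := digitMap_injective hN c
      have hF : ∀ t ∈ gsc N D, digitMap c t ∈ gsc N D := fun t ht => digitMap_mem_gsc hN hc ht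
      exact hcon c hc x' rfl ⟨hx', h.isOpen_left.preimage (continuous_digitMap c),
        h.isOpen_right.preimage (continuous_digitMap c),
        fun t ht htx => h.cover _ (hF t ht) (hinj.ne htx),
        fun t ht htx => h.disjoint _ (hF t ht) (hinj.ne htx),
        ⟨z, hz, fun e => hzx (e ▸ rfl), (h.cover _ (hF z hz) hzx).resolve_right hzv⟩,
        ⟨y, hy, fun e => hyx (e ▸ rfl), (h.cover _ (hF y hy) hyx).resolve_left hyu⟩⟩
    · have hsub : digitMap c '' gsc N D ⊆ gsc N D := by
        rintro _ ⟨y, hy, rfl⟩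
        exact digitMap_mem_gsc hN hc hy
      rcases h.subset_or_subset hsub
        (hconn.isPreconnected.image _ (continuous_digitMap c).continuousOn) hx with h1 | h1
      · exact Or.inl fun y hy _ => h1 ⟨y, hy, rfl⟩
      · exact Or.inr fun y hy _ => h1 ⟨y, hy, rfl⟩
  set p : Fin N × Fin N → Prop := fun c => ∀ y ∈ gsc N D, digitMap c y ≠ x → digitMap c y ∈ u
  set A := ⋃ i ∈ D.filter p, digitMap i '' gsc N D with hA
  set B := ⋃ i ∈ D.filter (¬ p ·), digitMap i '' gsc N D with hB
  have hAcl : IsClosed A :=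
    (Finset.isCompact_biUnion _ fun i _ => hcpt.image (continuous_digitMap i)).isClosed
  have hBcl : IsClosed B :=
    (Finset.isCompact_biUnion _ fun i _ => hcpt.image (continuous_digitMap i)).isClosed
  have hAu : ∀ y ∈ A, y ∈ gsc N D ∧ (y ≠ x → y ∈ u) := by
    intro y hy
    simp only [hA, Finset.mem_filter, Set.mem_iUnion, exists_prop] at hy
    obtain ⟨i, ⟨hi, hip⟩, t, ht, rfl⟩ := hy
    exact ⟨digitMap_mem_gsc hN hi ht, hip t ht⟩
  have hBv : ∀ y ∈ B, y ∈ gsc N D ∧ (y ≠ x → y ∈ v) := by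
    intro y hy
    simp only [hB, Finset.mem_filter, Set.mem_iUnion, exists_prop] at hy
    obtain ⟨i, ⟨hi, hip⟩, t, ht, rfl⟩ := hy
    exact ⟨digitMap_mem_gsc hN hi ht, (hmono i hi).resolve_left hip t ht⟩
  have hcov : gsc N D ⊆ A ∪ B := by
    intro y hy
    obtain ⟨i, hi, t, ht, rfl⟩ := (mem_gsc_iff hN hDne).1 hy
    by_cases hip : p i
    · exact Or.inl (Set.mem_biUnion (Finset.mem_coe.2 (Finset.mem_filter.2 ⟨hi, hip⟩)) ⟨t, ht, rfl⟩)
    · exact Or.inr (Set.mem_biUnion (Finset.mem_coe.2 (Finset.mem_filter.2 ⟨hi, hip⟩)) ⟨t, ht, rfl⟩)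
  -- The two groups of cells can meet only at `x`, and connectedness makes them meet, so the
  -- decomposition witnesses fragility.
  have hAB : ∀ y ∈ A ∩ B, y = x := by
    rintro y ⟨hyA, hyB⟩
    by_contra hyx
    exact h.disjoint y (hAu y hyA).1 hyx ((hAu y hyA).2 hyx) ((hBv y hyB).2 hyx)
  obtain ⟨y, hy, hyx, hyu⟩ := h.left
  obtain ⟨z, hz, hzx, hzv⟩ := h.right
  have hyA : y ∈ A := (hcov hy).resolve_right fun hyB => h.disjoint y hy hyx hyu ((hBv y hyB).2 hyx)
  have hzB : z ∈ B := (hcov hz).resolve_left fun hzA => h.disjoint z hz hzx ((hAu z hzA).2 hzx) hzv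
  obtain ⟨t, -, htAB⟩ := isPreconnected_closed_iff.1 hconn.isPreconnected A B hAcl hBcl hcov
    ⟨y, hy, hyA⟩ ⟨z, hz, hzB⟩
  refine hnf ⟨D.filter p, D.filter (¬ p ·), Finset.filter_union_filter_not_eq p D,
    Finset.disjoint_filter_filter_not D D p, x, ?_⟩
  ext s
  constructor
  · exact hAB s
  · rintro rfl
    rw [← hAB t htAB]
    exact htAB

/-! ### Points on the boundary of the square -/

open Classical in
/-- The number of coordinates of a point that are `0` or `1`. -/
noncomputable def boundaryCount (x : ℝ × ℝ) : ℕ :=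
  (if x.1 = 0 ∨ x.1 = 1 then 1 else 0) + (if x.2 = 0 ∨ x.2 = 1 then 1 else 0)

theorem boundaryCount_le (x : ℝ × ℝ) : boundaryCount x ≤ 2 := by
  unfold boundaryCount
  split_ifs <;> omega

theorem eq_zero_or_one_of_digit {t : ℝ} (h0 : 0 ≤ t) (h1 : t ≤ 1) (c : Fin N)
    (h : (t + (c : ℕ)) / N = 0 ∨ (t + (c : ℕ)) / N = 1) :
    (t = 0 ∧ (c : ℕ) = 0) ∨ (t = 1 ∧ (c : ℕ) + 1 = N) := by
  have hN : (0 : ℝ) < N := by exact_mod_cast c.pos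
  have hc : ((c : ℕ) : ℝ) + 1 ≤ N := by exact_mod_cast c.2
  have hc0 : (0 : ℝ) ≤ ((c : ℕ) : ℝ) := Nat.cast_nonneg _
  rcases h with h | h
  · rw [div_eq_zero_iff, or_iff_left hN.ne'] at h
    exact Or.inl ⟨by linarith, by exact_mod_cast (by linarith : ((c : ℕ) : ℝ) = 0)⟩
  · rw [div_eq_one_iff_eq hN.ne'] at h
    exact Or.inr ⟨by linarith, by exact_mod_cast (by linarith : ((c : ℕ) : ℝ) + 1 = N)⟩

/-- Intervals of two different digits meet only at a common endpoint, which lies strictly inside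
`[0, 1]`. -/
theorem eq_zero_or_one_of_two_digits {t s : ℝ} (ht0 : 0 ≤ t) (ht1 : t ≤ 1) (hs0 : 0 ≤ s)
    (hs1 : s ≤ 1) {c d : Fin N} (hcd : c ≠ d) (h : t + (c : ℕ) = s + (d : ℕ)) :
    (t = 0 ∨ t = 1) ∧ ¬ ((t + (c : ℕ)) / N = 0 ∨ (t + (c : ℕ)) / N = 1) := by
  have hne : (c : ℕ) ≠ d := fun e => hcd (Fin.ext e)
  constructor
  · rcases lt_or_gt_of_ne hne with hlt | hlt
    · have : ((c : ℕ) : ℝ) + 1 ≤ (d : ℕ) := by exact_mod_cast hlt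
      exact Or.inr (by linarith)
    · have : ((d : ℕ) : ℝ) + 1 ≤ (c : ℕ) := by exact_mod_cast hlt
      exact Or.inl (by linarith)
  · intro hb
    have h1 := eq_zero_or_one_of_digit ht0 ht1 c hb
    rw [h] at hb
    have h2 := eq_zero_or_one_of_digit hs0 hs1 d hb
    rcases h1 with ⟨rfl, h1⟩ | ⟨rfl, h1⟩ <;> rcases h2 with ⟨rfl, h2⟩ | ⟨rfl, h2⟩
    · omega
    · have : ((c : ℕ) : ℝ) = 0 := by exact_mod_cast h1
      have : (0 : ℝ) ≤ (d : ℕ) := Nat.cast_nonneg _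
      linarith
    · have : ((d : ℕ) : ℝ) = 0 := by exact_mod_cast h2
      have : (0 : ℝ) ≤ (c : ℕ) := Nat.cast_nonneg _
      linarith
    · omega

theorem boundaryCount_digitMap_le {x : ℝ × ℝ} (hx : x ∈ gsc N D) (c : Fin N × Fin N) :
    boundaryCount (digitMap c x) ≤ boundaryCount x := by
  obtain ⟨h1, h2, h3, h4⟩ := gsc_bounds hx
  have hi : (digitMap c x).1 = 0 ∨ (digitMap c x).1 = 1 → x.1 = 0 ∨ x.1 = 1 := fun h =>
    (eq_zero_or_one_of_digit h1 h2 c.1 h).imp And.left And.left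
  have hj : (digitMap c x).2 = 0 ∨ (digitMap c x).2 = 1 → x.2 = 0 ∨ x.2 = 1 := fun h =>
    (eq_zero_or_one_of_digit h3 h4 c.2 h).imp And.left And.left
  unfold boundaryCount
  split_ifs <;> first | omega | (exfalso; tauto)

/-- In a coordinate where the digits differ, `x` is on the boundary of the square but its image is
not; in the other coordinate nothing is gained. -/
theorem boundaryCount_lt_of_digitMap_eq (hN : 2 ≤ N) {x y : ℝ × ℝ} (hx : x ∈ gsc N D)
    (hy : y ∈ gsc N D) {c d : Fin N × Fin N} (hcd : c ≠ d) (h : digitMap c x = digitMap d y) :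
    boundaryCount (digitMap c x) < boundaryCount x := by
  rw [digitMap_eq_iff hN] at h
  obtain ⟨h1, h2, h3, h4⟩ := gsc_bounds hx
  obtain ⟨h5, h6, h7, h8⟩ := gsc_bounds hy
  have hi : (digitMap c x).1 = 0 ∨ (digitMap c x).1 = 1 → x.1 = 0 ∨ x.1 = 1 := fun h =>
    (eq_zero_or_one_of_digit h1 h2 c.1 h).imp And.left And.left
  have hj : (digitMap c x).2 = 0 ∨ (digitMap c x).2 = 1 → x.2 = 0 ∨ x.2 = 1 := fun h =>
    (eq_zero_or_one_of_digit h3 h4 c.2 h).imp And.left And.left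
  have hne : c.1 ≠ d.1 ∨ c.2 ≠ d.2 := by
    by_contra hcon
    push Not at hcon
    exact hcd (Prod.ext hcon.1 hcon.2)
  unfold boundaryCount
  rcases hne with hne | hne
  · have hk : (x.1 = 0 ∨ x.1 = 1) ∧ ¬ ((digitMap c x).1 = 0 ∨ (digitMap c x).1 = 1) :=
      eq_zero_or_one_of_two_digits h1 h2 h5 h6 hne h.1
    rw [if_pos hk.1, if_neg hk.2]
    split_ifs <;> first | omega | (exfalso; tauto)
  · have hk : (x.2 = 0 ∨ x.2 = 1) ∧ ¬ ((digitMap c x).2 = 0 ∨ (digitMap c x).2 = 1) :=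
      eq_zero_or_one_of_two_digits h3 h4 h7 h8 hne h.2
    rw [if_pos hk.1, if_neg hk.2]
    split_ifs <;> first | omega | (exfalso; tauto)

/-! ### Extremal separations -/

/-- A separation by a point with the largest possible number of coordinates in `{0, 1}`. -/
structure ExtremalSeparation (N : ℕ) (D : Finset (Fin N × Fin N)) (x : ℝ × ℝ)
    (u v : Set (ℝ × ℝ)) : Prop extends Separation N D x u v where
  extremal : ∀ x' u' v', Separation N D x' u' v' → boundaryCount x' ≤ boundaryCount x

theorem ExtremalSeparation.symm {x : ℝ × ℝ} {u v : Set (ℝ × ℝ)}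
    (h : ExtremalSeparation N D x u v) : ExtremalSeparation N D x v u :=
  ⟨h.toSeparation.symm, h.extremal⟩

theorem Separation.exists_extremal {x : ℝ × ℝ} {u v : Set (ℝ × ℝ)}
    (h : Separation N D x u v) : ∃ x u v, ExtremalSeparation N D x u v := by
  set S : Set ℕ := {n | ∃ x u v, Separation N D x u v ∧ boundaryCount x = n} with hS
  have hbdd : BddAbove S := by
    refine ⟨2, ?_⟩
    rintro _ ⟨x, u, v, -, rfl⟩
    exact boundaryCount_le x
  obtain ⟨x', u', v', h', hx'⟩ : sSup S ∈ S := Nat.sSup_mem ⟨_, x, u, v, h, rfl⟩ hbdd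
  exact ⟨x', u', v', h', fun y s t hy => hx' ▸ le_csSup hbdd ⟨y, s, t, hy, rfl⟩⟩

/-- `c` is the only first-level cell that contains the point `x = φ_c(x')`, and the separation of
`F \ {x}` restricts to an extremal separation of `φ_c(F) \ {x}`. -/
structure Zoom (N : ℕ) (D : Finset (Fin N × Fin N)) (x : ℝ × ℝ) (u v : Set (ℝ × ℝ))
    (c : Fin N × Fin N) (x' : ℝ × ℝ) : Prop where
  mem : c ∈ D
  map : digitMap c x' = x
  sep : ExtremalSeparation N D x' (digitMap c ⁻¹' u) (digitMap c ⁻¹' v)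
  unique : ∀ d ∈ D, d ≠ c → x ∉ digitMap d '' gsc N D

theorem Zoom.symm {x x' : ℝ × ℝ} {u v : Set (ℝ × ℝ)} {c : Fin N × Fin N}
    (h : Zoom N D x u v c x') : Zoom N D x v u c x' :=
  ⟨h.mem, h.map, h.sep.symm, h.unique⟩

/-- Magnifying cannot lower the boundary count, so it preserves extremality; a second first-level
cell through `x` would make the count grow strictly. -/
theorem ExtremalSeparation.exists_zoom (hN : 2 ≤ N) (hconn : IsConnected (gsc N D))
    (hnf : ¬ IsFragile N D) {x : ℝ × ℝ} {u v : Set (ℝ × ℝ)} (h : ExtremalSeparation N D x u v) :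
    ∃ c x', Zoom N D x u v c x' := by
  obtain ⟨c, hc, x', rfl, hs⟩ := h.toSeparation.exists_zoom hN hconn hnf
  refine ⟨c, x', hc, rfl, ⟨hs, fun y s t hy => (h.extremal y s t hy).trans
    (boundaryCount_digitMap_le hs.mem c)⟩, ?_⟩
  rintro d hd hdc ⟨y, hy, hyx⟩
  exact absurd (boundaryCount_lt_of_digitMap_eq hN hs.mem hy hdc.symm hyx.symm)
    (not_lt.2 (h.extremal _ _ _ hs))

/-- The set `u` contains every first-level cell other than `c`. -/
def ContainsOthers (D : Finset (Fin N × Fin N)) (c : Fin N × Fin N) (u : Set (ℝ × ℝ)) : Prop :=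
  ∀ d ∈ D, d ≠ c → digitMap d '' gsc N D ⊆ u

theorem digitMap_sub (hN : 2 ≤ N) (i j : Fin N × Fin N) (e₁ e₂ : ℤ) (z : ℝ × ℝ) :
    ((digitMap i z).1 - e₁, (digitMap i z).2 - e₂) =
      digitMap j (z.1 - ((N * e₁ + (j.1 : ℕ) - (i.1 : ℕ) : ℤ) : ℝ),
        z.2 - ((N * e₂ + (j.2 : ℕ) - (i.2 : ℕ) : ℤ) : ℝ)) := by
  have hN' : (N : ℝ) ≠ 0 := by positivity
  simp only [digitMap, Prod.mk.injEq]
  push_cast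
  constructor <;> field_simp <;> ring

theorem digitMap_eq_of_sub (hN : 2 ≤ N) {a c : Fin N × Fin N} {e₁ e₂ : ℤ}
    (h₁ : ((a.1 : ℕ) : ℤ) = (c.1 : ℕ) + e₁) (h₂ : ((a.2 : ℕ) : ℤ) = (c.2 : ℕ) + e₂) (y : ℝ × ℝ) :
    digitMap c y = digitMap a (y.1 - e₁, y.2 - e₂) := by
  rw [digitMap_eq_iff hN]
  have h1 : ((a.1 : ℕ) : ℝ) = (c.1 : ℕ) + e₁ := by exact_mod_cast h₁
  have h2 : ((a.2 : ℕ) : ℝ) = (c.2 : ℕ) + e₂ := by exact_mod_cast h₂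
  simp only [h1, h2]
  constructor <;> ring

theorem ne_of_sub {a c : Fin N × Fin N} {e₁ e₂ : ℤ} (he : e₁ ≠ 0 ∨ e₂ ≠ 0)
    (h₁ : ((a.1 : ℕ) : ℤ) = (c.1 : ℕ) + e₁) (h₂ : ((a.2 : ℕ) : ℤ) = (c.2 : ℕ) + e₂) : a ≠ c := by
  rintro rfl
  omega

/-- If the side changes from `c` to its subcell `c'`, all contacts of `c` with its siblings take
place in `c'`. -/
theorem onlyVia_of_switch (hN : 2 ≤ N) {x x' : ℝ × ℝ} {u v : Set (ℝ × ℝ)}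
    {c c' : Fin N × Fin N} (h : Separation N D x u v) (hz : Zoom N D x u v c x')
    (hu : ContainsOthers D c u) (hv : ContainsOthers D c' (digitMap c ⁻¹' v)) :
    ∀ e₁ e₂, (e₁ ≠ 0 ∨ e₂ ≠ 0) →
      IsDigit D (((c.1 : ℕ) : ℤ) + e₁) (((c.2 : ℕ) : ℤ) + e₂) →
        OnlyVia N (IsDigit D) (contact D) e₁ e₂ (c'.1 : ℕ) (c'.2 : ℕ) := by
  rintro e₁ e₂ he ⟨a, ha, ha₁, ha₂⟩ _ _ _ _ ⟨i, hi, rfl, rfl⟩ ⟨j, hj, rfl, rfl⟩ ⟨z, hz1, hz2⟩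
  by_contra hne
  have hic : i ≠ c' := by
    rintro rfl
    exact hne ⟨rfl, rfl⟩
  have hac := ne_of_sub he ha₁ ha₂
  have heq := digitMap_eq_of_sub hN ha₁ ha₂ (digitMap i z)
  rw [digitMap_sub hN i j] at heq
  have hq : digitMap c (digitMap i z) ∈ digitMap a '' gsc N D := by
    rw [heq]
    exact ⟨_, digitMap_mem_gsc hN hj hz2, rfl⟩
  refine h.disjoint _ (digitMap_mem_gsc hN hz.mem (digitMap_mem_gsc hN hi hz1)) ?_
    (hu a ha hac hq) (hv i hi hic ⟨z, hz1, rfl⟩)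
  rintro hqx
  exact hz.unique a ha hac (hqx ▸ hq)

/-- The siblings of `c` lie in `u` and the subcells of `cc'` other than `cc'c''` lie in `v`. They
could share only `x`, which no sibling of `c` contains. -/
theorem onlyVia_of_no_switch (hN : 2 ≤ N) {x x' x'' : ℝ × ℝ} {u v : Set (ℝ × ℝ)}
    {c c' c'' : Fin N × Fin N} (h : Separation N D x u v) (hz : Zoom N D x u v c x')
    (hz' : Zoom N D x' (digitMap c ⁻¹' u) (digitMap c ⁻¹' v) c' x'') (hu : ContainsOthers D c u)
    (hv : ContainsOthers D c'' (digitMap c' ⁻¹' (digitMap c ⁻¹' v))) :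
    ∀ e₁ e₂, (e₁ ≠ 0 ∨ e₂ ≠ 0) →
      IsDigit D (((c.1 : ℕ) : ℤ) + e₁) (((c.2 : ℕ) : ℤ) + e₂) → ∀ d₁ d₂, IsDigit D d₁ d₂ →
        OnlyVia N (IsDigit D) (contact D) (N * e₁ + d₁ - (c'.1 : ℕ)) (N * e₂ + d₂ - (c'.2 : ℕ))
          (c''.1 : ℕ) (c''.2 : ℕ) := by
  rintro e₁ e₂ he ⟨a, ha, ha₁, ha₂⟩ _ _ ⟨d, hd, rfl, rfl⟩ _ _ _ _ ⟨i, hi, rfl, rfl⟩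
    ⟨j, hj, rfl, rfl⟩ ⟨z, hz1, hz2⟩
  by_contra hne
  have hic : i ≠ c'' := by
    rintro rfl
    exact hne ⟨rfl, rfl⟩
  have hac := ne_of_sub he ha₁ ha₂
  have heq := digitMap_eq_of_sub hN ha₁ ha₂ (digitMap c' (digitMap i z))
  rw [digitMap_sub hN c' d, digitMap_sub hN i j] at heq
  have hq : digitMap c (digitMap c' (digitMap i z)) ∈ digitMap a '' gsc N D := by
    rw [heq]
    exact ⟨_, digitMap_mem_gsc hN hd (digitMap_mem_gsc hN hj hz2), rfl⟩
  refine h.disjoint _ (digitMap_mem_gsc hN hz.mem (digitMap_mem_gsc hN hz'.mem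
    (digitMap_mem_gsc hN hi hz1))) ?_ (hu a ha hac hq) (hv i hi hic ⟨z, hz1, rfl⟩)
  rintro hqx
  exact hz.unique a ha hac (hqx ▸ hq)

/-- Some extremal separation has whole first-level cells on both sides. -/
theorem ExtremalSeparation.exists_cells (hN : 2 ≤ N) (hD : 1 < D.card)
    (hconn : IsConnected (gsc N D)) (hnf : ¬ IsFragile N D) {x : ℝ × ℝ} {u v : Set (ℝ × ℝ)}
    (h : ExtremalSeparation N D x u v) :
    ∃ x u v, ExtremalSeparation N D x u v ∧ ∃ a ∈ D, ∃ b ∈ D,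
      (x ∉ digitMap a '' gsc N D ∧ digitMap a '' gsc N D ⊆ u) ∧
      (x ∉ digitMap b '' gsc N D ∧ digitMap b '' gsc N D ⊆ v) := by
  have hDne : D.Nonempty := Finset.card_pos.1 (by omega)
  by_contra hcon
  push Not at hcon
  have hmono : ∀ x u v c x', ExtremalSeparation N D x u v → Zoom N D x u v c x' →
      ContainsOthers D c u ∨ ContainsOthers D c v := by
    intro x u v c x' h hz
    by_contra hn
    simp only [ContainsOthers, not_or] at hn
    push Not at hn
    obtain ⟨⟨a, ha, hac, hau⟩, b, hb, hbc, hbv⟩ := hn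
    have hside : ∀ d ∈ D, d ≠ c → digitMap d '' gsc N D ⊆ u ∨ digitMap d '' gsc N D ⊆ v := by
      intro d hd hdc
      refine h.toSeparation.subset_or_subset ?_
        (hconn.isPreconnected.image _ (continuous_digitMap d).continuousOn) (hz.unique d hd hdc)
      rintro _ ⟨y, hy, rfl⟩
      exact digitMap_mem_gsc hN hd hy
    exact hcon x u v h b hb a ha
      ⟨hz.unique b hb hbc, (hside b hb hbc).resolve_right hbv⟩ (hz.unique a ha hac)
      ((hside a ha hac).resolve_left hau)
  -- A change of side confines the contacts of `c` with its siblings to `cc'`. One level deeper, if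
  -- the side returns to `u`, the contacts of `cc'` with its siblings are confined to `cc'c''`; if
  -- it stays `v`, those of `cc'` with cells outside `c` are.
  have hstep : ∀ x u v c x' c' x'', ExtremalSeparation N D x u v → Zoom N D x u v c x' →
      Zoom N D x' (digitMap c ⁻¹' u) (digitMap c ⁻¹' v) c' x'' → ContainsOthers D c u →
      ContainsOthers D c' (digitMap c ⁻¹' u) := by
    intro x u v c x' c' x'' h hz hz' hu
    refine (hmono _ _ _ _ _ hz.sep hz').resolve_right fun hv => ?_
    obtain ⟨c'', x''', hz''⟩ := hz'.sep.exists_zoom hN hconn hnf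
    refine (contactSystem_gsc hN hD hconn hnf).not_nested (isDigit_of_mem hz.mem)
      (isDigit_of_mem hz'.mem) (b₁ := (c''.1 : ℕ)) (b₂ := (c''.2 : ℕ))
      (onlyVia_of_switch hN h.toSeparation hz hu hv) ?_
    rcases hmono _ _ _ _ _ hz'.sep hz'' with hu'' | hv''
    · exact Or.inl (onlyVia_of_switch hN hz.sep.symm.toSeparation hz'.symm hv hu'')
    · exact Or.inr (onlyVia_of_no_switch hN h.toSeparation hz hz' hu hv'')
  -- With the siblings in `u` at every level, `v` meets `F \ {x}` only inside the nested cells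
  -- around `x`.
  have hsmall : ∀ n : ℕ, ∀ x u v c x', ExtremalSeparation N D x u v → Zoom N D x u v c x' →
      ContainsOthers D c u → ∀ y ∈ gsc N D, y ≠ x → y ∈ v → dist y x ≤ (1 / (N : ℝ)) ^ n := by
    intro n
    induction n with
    | zero =>
      intro x u v c x' h _ _ y hy _ _
      simpa using dist_le_one_of_mem_gsc hy h.mem
    | succ n ih =>
      intro x u v c x' h hz hu y hy hyx hyv
      obtain ⟨c', x'', hz'⟩ := hz.sep.exists_zoom hN hconn hnf
      obtain ⟨d, hd, y', hy', rfl⟩ := (mem_gsc_iff hN hDne).1 hy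
      have hdc : d = c := by
        by_contra hdc
        exact h.disjoint _ hy hyx (hu d hd hdc ⟨y', hy', rfl⟩) hyv
      subst hdc
      have hlt := ih _ _ _ _ _ hz.sep hz' (hstep _ _ _ _ _ _ _ h hz hz' hu) y' hy'
        (by rintro rfl; exact hyx hz.map) hyv
      rw [← hz.map, dist_digitMap, pow_succ, mul_one_div]
      gcongr
  have hnone : ∀ x u v c x', ExtremalSeparation N D x u v → Zoom N D x u v c x' →
      ContainsOthers D c u → False := by
    intro x u v c x' h hz hu
    obtain ⟨y, hy, hyx, hyv⟩ := h.right
    have hN1 : (1 : ℝ) / N < 1 := by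
      rw [div_lt_one (by positivity)]
      exact_mod_cast hN
    obtain ⟨n, hn⟩ := exists_pow_lt_of_lt_one (dist_pos.2 hyx) hN1
    exact absurd (hsmall n x u v c x' h hz hu y hy hyx hyv) (not_le.2 hn)
  obtain ⟨c, x', hz⟩ := h.exists_zoom hN hconn hnf
  rcases hmono _ _ _ _ _ h hz with hu | hv
  · exact hnone _ _ _ _ _ h hz hu
  · exact hnone _ _ _ _ _ h.symm hz.symm hv

/-! ### From cut points to Hata graphs -/

/-- Uniqueness of the first letter iterates because the magnified separation is again extremal. -/
theorem ExtremalSeparation.exists_unique_cell (hN : 2 ≤ N) (hconn : IsConnected (gsc N D))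
    (hnf : ¬ IsFragile N D) (k : ℕ) {x : ℝ × ℝ} {u v : Set (ℝ × ℝ)}
    (h : ExtremalSeparation N D x u v) :
    ∃ w : Fin k → D, x ∈ cell k w ∧ ∀ w', x ∈ cell k w' → w' = w := by
  induction k generalizing x u v with
  | zero => exact ⟨Fin.elim0, ⟨x, h.mem, rfl⟩, fun _ _ => Subsingleton.elim _ _⟩
  | succ k ih =>
    obtain ⟨c, x', hz⟩ := h.exists_zoom hN hconn hnf
    obtain ⟨t, hxt, ht⟩ := ih hz.sep
    refine ⟨Fin.cons ⟨c, hz.mem⟩ t, ?_, fun w hw => ?_⟩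
    · rw [cell_succ, Fin.cons_zero, Fin.tail_cons]
      exact ⟨x', hxt, hz.map⟩
    · rw [cell_succ] at hw
      obtain ⟨y, hy, hyx⟩ := hw
      have hc : (w 0 : Fin N × Fin N) = c := by
        by_contra hne
        exact hz.unique _ (w 0).2 hne ⟨y, cell_subset hN k _ hy, hyx⟩
      rw [hc, ← hz.map] at hyx
      obtain rfl := digitMap_injective hN c hyx
      rw [← Fin.cons_self_tail w, ht _ hy]
      congr 1
      exact Subtype.ext hc

/-- The words with first letter `a` lie in one component of `Γ_{k+1} - w`, if `w` does not begin
with `a`. -/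
theorem reachable_of_same_head (hN : 2 ≤ N) (hD : D.Nonempty) (hconn : IsConnected (gsc N D))
    {k : ℕ} {w : Fin (k + 1) → D} {a : D} (haw : w 0 ≠ a)
    {s t : ({w}ᶜ : Set (Fin (k + 1) → D))} (hs : s.1 0 = a) (ht : t.1 0 = a) :
    (deleteVertex (hataGraph N D (k + 1)) w).Reachable s t := by
  have hcpt := (isAttractor_gsc hN hD).2.1
  refine reachable_of_isPreconnected_biUnion _ (fun s => cell (k + 1) s.1)
    {s : ({w}ᶜ : Set (Fin (k + 1) → D)) | s.1 0 = a}
    (fun s _ => cell_nonempty hconn.nonempty _ _) (fun s _ => (isCompact_cell hcpt _ _).isClosed)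
    ?_ ?_ hs ht
  · have : (⋃ s ∈ {s : ({w}ᶜ : Set (Fin (k + 1) → D)) | s.1 0 = a}, cell (k + 1) s.1) =
        digitMap (a : Fin N × Fin N) '' gsc N D := by
      ext x
      simp only [Set.mem_iUnion, exists_prop]
      constructor
      · rintro ⟨s, rfl, hx⟩
        rw [cell_succ] at hx
        exact Set.image_mono (cell_subset hN k _) hx
      · rintro ⟨y, hy, rfl⟩
        obtain ⟨t, ht⟩ := exists_mem_cell hN hD k hy
        refine ⟨⟨Fin.cons a t, fun h => haw ?_⟩, rfl, ?_⟩
        · exact (congrFun (Set.mem_singleton_iff.1 h) 0).symm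
        · rw [cell_succ]
          exact ⟨y, ht, rfl⟩
    rw [this]
    exact hconn.isPreconnected.image _ (continuous_digitMap _).continuousOn
  · intro s _ t _ hst hne
    exact ⟨fun h => hst (Subtype.ext h), hne⟩

theorem le_chi_of_isCutPoint (hN : 2 ≤ N) (hD : 1 < D.card) (hconn : IsConnected (gsc N D))
    (hnf : ¬ IsFragile N D) {x : ℝ × ℝ} (hx : IsCutPoint (gsc N D) x) (k : ℕ) :
    D.card ^ k ≤ chi (hataGraph N D (k + 1)) := by
  have hDne : D.Nonempty := Finset.card_pos.1 (by omega)
  obtain ⟨u, v, hs⟩ := hx.exists_separation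
  obtain ⟨x, u, v, hs⟩ := hs.exists_extremal
  obtain ⟨x, u, v, hs, a, ha, b, hb, ⟨hxa, hau⟩, hxb, hbv⟩ := hs.exists_cells hN hD hconn hnf
  obtain ⟨w, hw, huniq⟩ := hs.exists_unique_cell hN hconn hnf (k + 1)
  have hhead : ∀ c : D, x ∉ digitMap (c : Fin N × Fin N) '' gsc N D → w 0 ≠ c := by
    rintro c hxc rfl
    rw [cell_succ] at hw
    exact hxc (Set.image_mono (cell_subset hN k _) hw)
  have hcell : ∀ (c : D) (t : Fin k → D),
      cell (k + 1) (Fin.cons c t) ⊆ digitMap (c : Fin N × Fin N) '' gsc N D := by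
    intro c t
    rw [cell_succ, Fin.cons_zero]
    exact Set.image_mono (cell_subset hN k _)
  have hmem : ∀ (c : D), w 0 ≠ c → ∀ t : Fin k → D,
      (Fin.cons c t : Fin (k + 1) → D) ∈ ({w}ᶜ : Set (Fin (k + 1) → D)) := by
    intro c hc t h
    apply hc
    rw [← Set.mem_singleton_iff.1 h, Fin.cons_zero]
  have hlarge : ∀ (c : D) (hc : w 0 ≠ c) (t : Fin k → D), D.card ^ k ≤
      ((deleteVertex (hataGraph N D (k + 1)) w).connectedComponentMk
        ⟨Fin.cons c t, hmem c hc t⟩).supp.ncard := by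
    intro c hc t
    have hinj : Function.Injective (fun t : Fin k → D =>
        (⟨Fin.cons c t, hmem c hc t⟩ : ({w}ᶜ : Set (Fin (k + 1) → D)))) := by
      intro s t hst
      exact Fin.cons_right_injective (α := fun _ => D) c (Subtype.ext_iff.1 hst)
    calc D.card ^ k = (Set.univ : Set (Fin k → D)).ncard := by
          rw [Set.ncard_univ, Nat.card_eq_fintype_card]
          simp
      _ = _ := (Set.ncard_image_of_injective _ hinj).symm
      _ ≤ _ := by
          refine Set.ncard_le_ncard ?_ (Set.toFinite _)
          rintro _ ⟨s, -, rfl⟩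
          exact SimpleGraph.ConnectedComponent.sound
            (reachable_of_same_head hN hDne hconn hc rfl rfl)
  have ha' := hhead ⟨a, ha⟩ hxa
  have hb' := hhead ⟨b, hb⟩ hxb
  set t : Fin k → D := fun _ => ⟨a, ha⟩
  refine (le_chi_iff _ (by positivity)).2 ⟨w, _, _, ?_, hlarge _ ha' t, hlarge _ hb' t⟩
  intro heq
  have hreach := SimpleGraph.ConnectedComponent.exact heq
  -- Cells other than that of `w` miss `x`, so each lies on one side; adjacent ones share a point
  -- other than `x`, so the side `u` propagates along walks.
  have hprop : ∀ p q : ({w}ᶜ : Set (Fin (k + 1) → D)),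
      (deleteVertex (hataGraph N D (k + 1)) w).Reachable p q →
      cell (k + 1) p.1 ⊆ u → cell (k + 1) q.1 ⊆ u := by
    rintro p q ⟨W⟩
    induction W with
    | nil => exact id
    | @cons p q _ hadj _ ih =>
      intro hp
      refine ih ?_
      obtain ⟨-, y, hyp, hyq⟩ := hadj
      refine (hs.toSeparation.subset_or_subset (cell_subset hN _ _)
        (isConnected_cell hconn _ _).isPreconnected fun hxq => q.2 (huniq _ hxq)).resolve_right ?_
      intro hq
      refine hs.disjoint y (cell_subset hN _ _ hyp) ?_ (hp hyp) (hq hyq)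
      rintro rfl
      exact p.2 (huniq _ hyp)
  obtain ⟨y, hy⟩ := cell_nonempty hconn.nonempty (k + 1) (Fin.cons ⟨b, hb⟩ t : Fin (k + 1) → D)
  refine hs.disjoint y (cell_subset hN _ _ hy) ?_
    (hprop _ _ hreach ((hcell _ t).trans hau) hy) (hbv (hcell _ t hy))
  rintro rfl
  exact hxb (hcell _ t hy)

end Contact

end FractalSquare

theorem theorem1p7 (N : ℕ) (hN : 2 ≤ N) (D : Finset (Fin N × Fin N))
    (hD₁ : 1 < D.card) (hD₂ : D.card < N ^ 2)
    (hconn : IsConnected (FractalSquare.gsc N D))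
    (hnf : ¬ FractalSquare.IsFragile N D) :
    ((∃ x, FractalSquare.IsCutPoint (FractalSquare.gsc N D) x) ↔
      ∀ k : ℕ, 2 ≤ k → D.card ^ (k - 1) ≤ FractalSquare.chi (FractalSquare.hataGraph N D k)) ∧
    ((∃ k₀ : ℕ, 2 ≤ k₀ ∧
        ∀ k : ℕ, k₀ ≤ k →
          D.card ^ (k - 1) ≤ FractalSquare.chi (FractalSquare.hataGraph N D k)) →
      ∃ x, FractalSquare.IsCutPoint (FractalSquare.gsc N D) x) := by
  -- The converse is the case `k₀ = 2` of the eventual statement.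
  refine ⟨⟨?_, fun h => FractalSquare.exists_isCutPoint_of_chi hN hD₁ hconn h⟩, ?_⟩
  · rintro ⟨x, hx⟩ k hk
    obtain ⟨k, rfl⟩ : ∃ k', k = k' + 1 := ⟨k - 1, by omega⟩
    exact FractalSquare.le_chi_of_isCutPoint hN hD₁ hconn hnf hx k
  · rintro ⟨k₀, -, h⟩
    exact FractalSquare.exists_isCutPoint_of_chi hN hD₁ hconn h
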